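/- Conventions and notation. Let $n\ge 1$; $B(0,r)$ is the open ball in $\mathbb R^n$ with centre $0$ and radius $r$, and ${}^{c}B(0,r)=\mathbb R^n\setminus B(0,r)$. We put $0\cdot\infty=0$ and $1/\infty=0$. A weight on $\mathbb R^n$ is a measurable function that is positive and finite almost everywhere. For measurable $f$, a measurable set $A$ and $w\ge 0$ put $\|f\|_{p,w,A}=\left(\int_A|f|^p w\,dx\right)^{1/p}$ if $0<p<\infty$ and $\|f\|_{\infty,w,A}=\operatorname{ess\,sup}_A|f|w$; $\|f\|_{p,A}$ is the case $w\equiv 1$. For a weight $v$, $L_p(\mathbb R^n,v)$ is the space of measurable $f$ with $\|f\|_{p,v,\mathbb R^n}<\infty$. For $0<p,\theta\le\infty$ and a non-negative measurable $\omega$ on $(0,\infty)$, $LM_{p\theta,\omega}(\mathbb R^n,v)$ is the space of all $f\in L^{\mathrm{loc}}_{p,v}(\mathbb R^n)$ with $$\|f\|_{LM_{p\theta,\omega}(\mathbb R^n,v)}=\left\|\,\omega(r)\,\|f\|_{p,v,B(0,r)}\right\|_{\theta,(0,\infty)}<\infty .$$ $\Omega_\theta$ is the set of all non-negative measurable $\omega$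 on $(0,\infty)$ with $0<\|\omega\|_{\theta,(t,\infty)}<\infty$ for every $t>0$, and $\|\omega\|_{\theta,(t-,\infty)}=\lim_{s\to t-}\|\omega\|_{\theta,(s,\infty)}$. For $LM=LM_{p_2\theta,\omega}(\mathbb R^n,v_2)$ and $L=L_{p_1}(\mathbb R^n,v_1)$, $\|\mathrm{Id}\|_{LM\to L}\in[0,\infty]$ is the infimum of the $c\in(0,\infty)$ such that $LM\subset L$ and $\|f\|_{L}\le c\|f\|_{LM}$ for all $f\in LM$ (it is $\infty$ if there is no such $c$). We write $X\approx Y$ for $X,Y\in[0,\infty]$ if $X\le CY$ and $Y\le CX$ with a constant $C\in(0,\infty)$ that depends only on $n,p_1,p_2,\theta$ (and not on $\omega,v_1,v_2$). Put $$\sigma=\frac{p_1p_2}{p_2-p_1}\ \ (\sigma=\infty\text{ if }p_1=p_2),\qquad s=\frac{p_1\theta}{\theta-p_1}\ \ (s=p_1\text{ if }\theta=\infty).$$ Theorem. Let $0<p_1\le p_2<\infty$, $0<\theta\le\infty$, let $v_1,v_2$ be weights on $\mathbb R^n$ and let $\omega\in\Omega_\theta$. (a) If $\theta\le p_1$, then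 $$\|\mathrm{Id}\|_{LM_{p_2\theta,\omega}(\mathbb R^n,v_2)\to L_{p_1}(\mathbb R^n,v_1)}\approx\sup_{t>0}\ \|\omega\|_{\theta,(t,\infty)}^{-1}\left\|v_1^{1/p_1}v_2^{-1/p_2}\right\|_{\sigma,{}^{c}B(0,t)} .$$ (b) If $p_1<\theta\le\infty$, then $$\|\mathrm{Id}\|_{LM_{p_2\theta,\omega}(\mathbb R^n,v_2)\to L_{p_1}(\mathbb R^n,v_1)}\approx\left(\int_{(0,\infty)}\left\|v_1^{1/p_1}v_2^{-1/p_2}\right\|_{\sigma,{}^{c}B(0,t)}^{s}\,d\left(\|\omega\|_{\theta,(t-,\infty)}^{-s}\right)\right)^{1/s}+\|\omega\|_{\theta,(0,\infty)}^{-1}\left\|v_1^{1/p_1}v_2^{-1/p_2}\right\|_{\sigma,\mathbb R^n},$$ where the integral is the Lebesgue--Stieltjes integral with respect to the finite, non-decreasing, left-continuous function $t\mapsto\|\omega\|_{\theta,(t-,\infty)}^{-s}$ on $(0,\infty)$, that is, with respect to the Borel measure $\lambda$ on $(0,\infty)$ with $\lambda([\alpha,\beta))=\|\omega\|_{\theta,(\beta-,\infty)}^{-s}-\|\omega\|_{\theta,(\alpha-,\infty)}^{-s}$.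 -/

import Mathlib

open MeasureTheory Set
open scoped ENNReal NNReal

noncomputable section

namespace LocalMorrey

/-- The space `ℝⁿ` with the Euclidean norm and Lebesgue measure. -/
abbrev Rn (n : ℕ) : Type := EuclideanSpace ℝ (Fin n)

/-- The functional `‖f‖_{p,A,w}` of a `[0,∞]`-valued function `f` (in applications `|f|`):
`(∫_A f^p w)^{1/p}` for `p < ∞`, and the essential supremum of `f w` over `A` for `p = ∞`. -/
def wNorm {α : Type*} [MeasureSpace α] (p : ℝ≥0∞) (A : Set α) (w f : α → ℝ≥0∞) : ℝ≥0∞ :=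
  if p = ∞ then essSup (fun x => f x * w x) (volume.restrict A)
  else (∫⁻ x in A, f x ^ p.toReal * w x) ^ (1 / p.toReal)

/-- The unweighted functional `‖f‖_{p,A}`. -/
def uNorm {α : Type*} [MeasureSpace α] (p : ℝ≥0∞) (A : Set α) (f : α → ℝ≥0∞) : ℝ≥0∞ :=
  wNorm p A (fun _ => 1) f

/-- Weights on `ℝⁿ`: (Lebesgue) measurable, positive and finite almost everywhere. -/
def IsWeight {n : ℕ} (v : Rn n → ℝ≥0∞) : Prop :=
  AEMeasurable v ∧ ∀ᵐ x, 0 < v x ∧ v x < ∞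

/-- The quasi-norm of `L_p(ℝⁿ, v)`. -/
def lebNorm {n : ℕ} (p : ℝ≥0∞) (v : Rn n → ℝ≥0∞) (f : Rn n → ℝ) : ℝ≥0∞ :=
  wNorm p univ v (fun x => ‖f x‖ₑ)

/-- The weighted Lebesgue space `L_p(ℝⁿ, v)`. -/
def lebSpace {n : ℕ} (p : ℝ≥0∞) (v : Rn n → ℝ≥0∞) : Set (Rn n → ℝ) :=
  {f | AEMeasurable f ∧ lebNorm p v f < ∞}

/-- The space `L_{p,v}^{loc}(ℝⁿ)`. -/
def lebLocSpace {n : ℕ} (p : ℝ≥0∞) (v : Rn n → ℝ≥0∞) : Set (Rn n → ℝ) :=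
  {f | AEMeasurable f ∧ ∀ K : Set (Rn n), IsCompact K → wNorm p K v (fun x => ‖f x‖ₑ) < ∞}

/-- The quasi-norm `‖ ω(r) ‖f‖_{p,v,B(0,r)} ‖_{θ,(0,∞)}` of the weighted local Morrey-type space. -/
def morreyNorm {n : ℕ} (p θ : ℝ≥0∞) (ω : ℝ → ℝ≥0∞) (v : Rn n → ℝ≥0∞) (f : Rn n → ℝ) : ℝ≥0∞ :=
  uNorm θ (Ioi (0 : ℝ)) (fun r => ω r * wNorm p (Metric.ball 0 r) v (fun x => ‖f x‖ₑ))

/-- The weighted local Morrey-type space `LM_{pθ,ω}(ℝⁿ, v)`. -/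
def morreySpace {n : ℕ} (p θ : ℝ≥0∞) (ω : ℝ → ℝ≥0∞) (v : Rn n → ℝ≥0∞) : Set (Rn n → ℝ) :=
  {f | f ∈ lebLocSpace p v ∧ morreyNorm p θ ω v f < ∞}

/-- `‖ω‖_{θ,(t,∞)}`. -/
def tail (θ : ℝ≥0∞) (ω : ℝ → ℝ≥0∞) (t : ℝ) : ℝ≥0∞ := uNorm θ (Ioi t) ω

/-- The class `Ω_θ`: measurable `ω ≥ 0` on `(0,∞)` with `0 < ‖ω‖_{θ,(t,∞)} < ∞` for all `t > 0`.
Only the values of `ω` on `(0,∞)` matter. -/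
def IsOmega (θ : ℝ≥0∞) (ω : ℝ → ℝ≥0∞) : Prop :=
  AEMeasurable ω (volume.restrict (Ioi 0)) ∧ ∀ t : ℝ, 0 < t → 0 < tail θ ω t ∧ tail θ ω t < ∞

/-- `X ⊆ Y` and `‖f‖_Y ≤ c ‖f‖_X` for all `f ∈ X`. -/
def IsEmbedConst {F : Type*} (X Y : Set F) (NX NY : F → ℝ≥0∞) (c : ℝ≥0) : Prop :=
  X ⊆ Y ∧ ∀ f ∈ X, NY f ≤ c * NX f

/-- The best constant of the embedding `X ↪ Y`; it is `∞` if there is no such embedding. -/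
def embedNorm {F : Type*} (X Y : Set F) (NX NY : F → ℝ≥0∞) : ℝ≥0∞ :=
  ⨅ (c : ℝ≥0) (_ : 0 < c ∧ IsEmbedConst X Y NX NY c), (c : ℝ≥0∞)

/-- `‖Id‖` for the embedding `LM_{p₂θ,ω}(ℝⁿ, v₂) ↪ L_{p₁}(ℝⁿ, v₁)`. -/
def idNorm {n : ℕ} (p₁ p₂ θ : ℝ≥0∞) (v₁ v₂ : Rn n → ℝ≥0∞) (ω : ℝ → ℝ≥0∞) : ℝ≥0∞ :=
  embedNorm (morreySpace p₂ θ ω v₂) (lebSpace p₁ v₁) (morreyNorm p₂ θ ω v₂) (lebNorm p₁ v₁)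

/-- The exponent `pq/(q-p)`, that is, `s` with `1/s = 1/p - 1/q`, for `0 < p ≤ q ≤ ∞`; it is `∞` if
`p = q` and it is `p` if `q = ∞`. -/
def gapExp (p q : ℝ≥0∞) : ℝ≥0∞ := (p⁻¹ - q⁻¹)⁻¹

theorem gapExp_self (p : ℝ≥0∞) : gapExp p p = ∞ := by simp [gapExp]

theorem gapExp_top (p : ℝ≥0∞) : gapExp p ∞ = p := by simp [gapExp]

theorem gapExp_ofReal {p q : ℝ} (hp : 0 < p) (hpq : p < q) :
    gapExp (ENNReal.ofReal p) (ENNReal.ofReal q) = ENNReal.ofReal (p * q / (q - p)) := by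
  have hq : 0 < q := hp.trans hpq
  have hd : 0 < q - p := sub_pos.2 hpq
  have h1 : p⁻¹ - q⁻¹ = (q - p) / (p * q) := by field_simp
  rw [gapExp, ← ENNReal.ofReal_inv_of_pos hp, ← ENNReal.ofReal_inv_of_pos hq,
    ← ENNReal.ofReal_sub _ (by positivity), h1, ← ENNReal.ofReal_inv_of_pos (by positivity),
    inv_div]

/-- `‖v₁^{1/p₁} v₂^{-1/p₂}‖_{p₁p₂/(p₂-p₁),A}`. -/
def ratioNorm {n : ℕ} (p₁ p₂ : ℝ≥0∞) (v₁ v₂ : Rn n → ℝ≥0∞) (A : Set (Rn n)) : ℝ≥0∞ :=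
  uNorm (gapExp p₁ p₂) A (fun x => v₁ x ^ (1 / p₁.toReal) * v₂ x ^ (-(1 / p₂.toReal)))

/-- A function `h : (0,∞) → [0,∞)` extended by `0` to a real function on `ℝ`. -/
def zeroExt (h : ℝ → ℝ≥0∞) (t : ℝ) : ℝ := if 0 < t then (h t).toReal else 0

open Classical in
/-- The Lebesgue-Stieltjes measure on `(0,∞)` of a finite, non-negative and non-decreasing function
`h` on `(0,∞)` (the value carries no meaning for other `h`). The possible atom at `0` of the extension of
`h` is removed, and what remains is the Borel measure on `(0,∞)` with
`λ([a,b]) = h(b+) - h(a-)`; for a left-continuous `h`, `λ([a,b)) = h(b) - h(a)`. -/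
def lsMeasure (h : ℝ → ℝ≥0∞) : Measure ℝ :=
  if hm : Monotone (zeroExt h) then hm.stieltjesFunction.measure.restrict (Ioi 0) else 0

/-- The function `t ↦ ‖ω‖_{θ,(t-,∞)}^{-s}`, where `‖ω‖_{θ,(t-,∞)} = lim_{s → t-} ‖ω‖_{θ,(s,∞)}`. -/
def tailPow (θ : ℝ≥0∞) (ω : ℝ → ℝ≥0∞) (s : ℝ) (t : ℝ) : ℝ≥0∞ :=
  Function.leftLim (tail θ ω) t ^ (-s)

theorem tail_antitone (θ : ℝ≥0∞) (ω : ℝ → ℝ≥0∞) : Antitone (tail θ ω) := by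
  intro a b hab
  have hsub : (volume : Measure ℝ).restrict (Ioi b) ≤ volume.restrict (Ioi a) :=
    Measure.restrict_mono (Ioi_subset_Ioi hab) le_rfl
  unfold tail uNorm wNorm
  split_ifs with h
  · exact essSup_mono_measure (Measure.absolutelyContinuous_of_le hsub)
  · exact ENNReal.rpow_le_rpow (lintegral_mono' hsub le_rfl) (by positivity)

theorem leftLim_tail_bounds {θ : ℝ≥0∞} {ω : ℝ → ℝ≥0∞} (hω : IsOmega θ ω) {t : ℝ} (ht : 0 < t) :
    0 < Function.leftLim (tail θ ω) t ∧ Function.leftLim (tail θ ω) t < ∞ :=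
  ⟨(hω.2 t ht).1.trans_le ((tail_antitone θ ω).le_leftLim le_rfl),
    ((tail_antitone θ ω).leftLim_le (half_lt_self ht)).trans_lt (hω.2 _ (half_pos ht)).2⟩

/-- For `ω ∈ Ω_θ` the function `tailPow θ ω s` is finite on `(0,∞)`. -/
theorem tailPow_lt_top {θ : ℝ≥0∞} {ω : ℝ → ℝ≥0∞} (hω : IsOmega θ ω) (s : ℝ) {t : ℝ} (ht : 0 < t) :
    tailPow θ ω s t < ∞ :=
  (ENNReal.rpow_ne_top_of_ne_zero (leftLim_tail_bounds hω ht).1.ne'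
    (leftLim_tail_bounds hω ht).2.ne).lt_top

/-- For `ω ∈ Ω_θ` and `s ≥ 0` the function `tailPow θ ω s` is non-decreasing, so that its
Lebesgue-Stieltjes measure is the genuine one. -/
theorem zeroExt_tailPow_monotone {θ : ℝ≥0∞} {ω : ℝ → ℝ≥0∞} (hω : IsOmega θ ω) {s : ℝ}
    (hs : 0 ≤ s) : Monotone (zeroExt (tailPow θ ω s)) := by
  intro a b hab
  unfold zeroExt
  split_ifs with ha hb hb
  · refine ENNReal.toReal_mono (tailPow_lt_top hω s hb).ne ?_
    unfold tailPow
    rw [ENNReal.rpow_neg, ENNReal.rpow_neg, ENNReal.inv_le_inv]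
    exact ENNReal.rpow_le_rpow ((tail_antitone θ ω).leftLim hab) hs
  · exact absurd (ha.trans_le hab) hb
  · exact ENNReal.toReal_nonneg
  · exact le_rfl

end LocalMorrey

end

open LocalMorrey

noncomputable section

namespace LocalMorrey

/-! Write T(t) = ‖ω‖_{θ,(t,∞)}, W = v₁^{1/p₁} v₂^{-1/p₂} and σ = `gapExp p₁ p₂`. The function T is
non-increasing, and (0,∞) is cut into layers where 2^{-k-1} < T ≤ 2^{-k}. This turns the embedding
into a diagonal multiplier problem from ℓ^θ to ℓ^{p₁}.

Upper bounds. Hölder on the k-th shell (`wNorm_le_ratioNorm_mul`) bounds ‖f‖_{p₁,v₁} there by ‖W‖_σ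
outside a ball times ‖f‖_{p₂,v₂} inside a slightly larger one. With K_k = 2^k ‖W‖_{σ,{T(|x|) ≤
2^{-k}}}, this bounds the L_{p₁} norm by an ℓ^{p₁} norm of products of K_k with a sequence whose ℓ^θ
norm is at most a multiple of the Morrey norm (`tsum_innerNorm_le`, `innerNorm_top_le`). If θ ≤ p₁,
then ℓ^θ ⊆ ℓ^{p₁} leaves sup K_k. If p₁ < θ, Hölder for series (at θ = ∞, extraction of the
supremum) leaves the ℓ^s norm of K_k.

Continuous form. The ℓ^s norm of K_k is comparable to the Stieltjes expression in (b): a layer has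
λ-measure at most 2^{s(k+1)}, and (0,R] with T(R) ≤ 2^{-k} has λ-measure at least 2^{sk} - T(0)^{-s}
(`tsum_outerRatio_le`, `lintegral_lsMeasure_le`). The second term of (b) pays for the missing
T(0)^{-s}.

Lower bounds. `exists_test` inverts Hölder's inequality. For θ ≤ p₁ one almost extremal function
living off B(0,t) suffices. For p₁ < θ, such functions on the shells are combined with the
coefficients extremal for Hölder in series (`sum_shellRatio_le_of_lt`). This bounds the shell norms
of W in ℓ^s, and a discrete Hardy inequality (`outerRatio_le_iSup`) passes from shells to exteriors.
-/

/-- The dyadic number `2^{-k}`. -/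
def dyadic (k : ℤ) : ℝ≥0∞ := 2 ^ (-(k : ℝ))

/-! ### Powers of two and inequalities for sequences over ℤ. -/

theorem two_rpow_pos (x : ℝ) : (0 : ℝ≥0∞) < 2 ^ x :=
  ENNReal.rpow_pos (by norm_num) (by norm_num)

theorem two_rpow_ne_top (x : ℝ) : (2 : ℝ≥0∞) ^ x ≠ ∞ :=
  ENNReal.rpow_ne_top_of_ne_zero (by norm_num) (by norm_num)

theorem two_rpow_add (x y : ℝ) : (2 : ℝ≥0∞) ^ (x + y) = 2 ^ x * 2 ^ y :=
  ENNReal.rpow_add _ _ (by norm_num) (by norm_num)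

theorem two_rpow_le {x y : ℝ} (h : x ≤ y) : (2 : ℝ≥0∞) ^ x ≤ 2 ^ y :=
  ENNReal.rpow_le_rpow_of_exponent_le (by norm_num) h

theorem dyadic_pos (k : ℤ) : 0 < dyadic k := two_rpow_pos _

theorem dyadic_ne_top (k : ℤ) : dyadic k ≠ ∞ := two_rpow_ne_top _

theorem dyadic_le_of_le {j k : ℤ} (h : j ≤ k) : dyadic k ≤ dyadic j := by
  apply two_rpow_le; have : (j : ℝ) ≤ k := by exact_mod_cast h
  linarith

theorem lt_of_dyadic_lt {j k : ℤ} (h : dyadic k < dyadic j) : j < k := by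
  by_contra! h'; exact absurd (dyadic_le_of_le h') (not_le.2 h)

theorem dyadic_inv (k : ℤ) : (dyadic k)⁻¹ = 2 ^ (k : ℝ) := by
  rw [dyadic, ENNReal.rpow_neg, inv_inv]

theorem dyadic_eq_two_mul (k : ℤ) : dyadic k = 2 * dyadic (k + 1) := by
  have : (-(k : ℝ)) = 1 + (-((k + 1 : ℤ) : ℝ)) := by push_cast; ring
  rw [dyadic, dyadic, this, two_rpow_add, ENNReal.rpow_one]

theorem exists_dyadic {a : ℝ≥0∞} (h0 : a ≠ 0) (h : a ≠ ∞) :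
    ∃ k : ℤ, a ∈ Ioc (dyadic (k + 1)) (dyadic k) := by
  obtain ⟨m, hm⟩ := ENNReal.exists_mem_Ioc_zpow h0 h (y := 2) (by norm_num) (by norm_num)
  refine ⟨-(m + 1), ?_⟩
  have e : ∀ l : ℤ, dyadic l = 2 ^ (-l) := fun l => by
    rw [dyadic, ← ENNReal.rpow_intCast]; push_cast; rfl
  rw [e, e]
  simpa using hm

/-- `∑_k 2^{-ε|k|}` over the integers. -/
def geomSum (ε : ℝ) : ℝ≥0∞ := ∑' k : ℤ, (2 : ℝ≥0∞) ^ (-(ε * |(k : ℝ)|))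

theorem geomSum_ne_top {ε : ℝ} (hε : 0 < ε) : geomSum ε ≠ ∞ := by
  have h1 : ∑' k : ℕ, ((2 : ℝ≥0∞) ^ (-ε)) ^ k ≠ ∞ := by
    rw [ENNReal.tsum_geometric]
    refine ENNReal.inv_ne_top.2 (tsub_pos_of_lt ?_).ne'
    exact ENNReal.rpow_lt_one_of_one_lt_of_neg (by norm_num) (by linarith)
  have e : ∀ k : ℕ, ((2 : ℝ≥0∞) ^ (-ε)) ^ k = 2 ^ (-(ε * k)) := fun k => by
    rw [← ENNReal.rpow_natCast, ← ENNReal.rpow_mul]; ring_nf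
  have hs := HasSum.of_nat_of_neg_add_one
    (f := fun k : ℤ => (2 : ℝ≥0∞) ^ (-(ε * |(k : ℝ)|)))
    ENNReal.summable.hasSum ENNReal.summable.hasSum
  rw [geomSum, hs.tsum_eq]
  refine ENNReal.add_ne_top.2 ⟨?_, ?_⟩
  · refine ne_top_of_le_ne_top h1 (ENNReal.tsum_le_tsum fun k => ?_)
    rw [e]; simp
  · refine ne_top_of_le_ne_top h1 (ENNReal.tsum_le_tsum fun k => ?_)
    rw [e]; apply two_rpow_le
    push_cast
    rw [abs_neg, abs_of_nonneg (by positivity)]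
    nlinarith

theorem one_le_geomSum (ε : ℝ) : 1 ≤ geomSum ε := by
  refine le_trans ?_ (ENNReal.le_tsum (0 : ℤ)); simp

theorem tsum_two_rpow_dist (ε : ℝ) (k : ℤ) :
    ∑' j : ℤ, (2 : ℝ≥0∞) ^ (-(ε * |(j : ℝ) - k|)) = geomSum ε := by
  rw [geomSum, ← (Equiv.subRight k).tsum_eq fun j : ℤ => (2 : ℝ≥0∞) ^ (-(ε * |(j : ℝ)|))]
  simp

/-- Young's inequality for the maximal convolution with `2^{-|k|/2}`. -/
theorem tsum_rpow_le_of_le_iSup {s : ℝ} (hs : 0 < s) {X x : ℤ → ℝ≥0∞}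
    (h : ∀ k, X k ≤ ⨆ j : ℤ, 2 ^ (-(1 / 2 * |(j : ℝ) - k|)) * x j) :
    ∑' k, X k ^ s ≤ geomSum (s / 2) * ∑' j, x j ^ s := by
  -- The power of a supremum is at most the sum of the powers, so no triangle inequality is needed
  -- and s < 1 is allowed.
  have h1 : ∀ k, X k ^ s ≤ ∑' j : ℤ, 2 ^ (-(s / 2 * |(k : ℝ) - j|)) * x j ^ s := fun k => by
    rw [← ENNReal.le_rpow_inv_iff hs]
    refine (h k).trans (iSup_le fun j => ?_)
    rw [ENNReal.le_rpow_inv_iff hs]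
    refine le_trans ?_ (ENNReal.le_tsum j)
    rw [ENNReal.mul_rpow_of_nonneg _ _ hs.le, ← ENNReal.rpow_mul, abs_sub_comm]
    apply le_of_eq; ring_nf
  refine (ENNReal.tsum_le_tsum h1).trans (le_of_eq ?_)
  rw [ENNReal.tsum_comm, ← ENNReal.tsum_mul_left]
  congr 1; ext j
  rw [ENNReal.tsum_mul_right, tsum_two_rpow_dist]

theorem iSup_le_of_le_iSup {X x : ℤ → ℝ≥0∞}
    (h : ∀ k, X k ≤ ⨆ j : ℤ, 2 ^ (-(1 / 2 * |(j : ℝ) - k|)) * x j) : ⨆ k, X k ≤ ⨆ k, x k := by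
  refine iSup_le fun k => (h k).trans (iSup_mono fun j => ?_)
  have : (2 : ℝ≥0∞) ^ (-(1 / 2 * |(j : ℝ) - k|)) ≤ 2 ^ (0 : ℝ) :=
    two_rpow_le (by have := abs_nonneg ((j : ℝ) - k); linarith)
  calc _ ≤ 2 ^ (0 : ℝ) * x j := by gcongr
    _ = x j := by simp

/-- A sum of powers of two is controlled by its largest term. -/
theorem tsum_indicator_two_rpow_le {s : ℝ} (hs : 0 < s) (S : Set ℤ) {M : ℝ≥0∞}
    (h : ∀ k ∈ S, (2 : ℝ≥0∞) ^ (s * k) ≤ M) :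
    ∑' k : ℤ, S.indicator (fun k : ℤ => (2 : ℝ≥0∞) ^ (s * k)) k ≤ geomSum s * M := by
  rcases S.eq_empty_or_nonempty with rfl | hne
  · simp
  by_cases hb : BddAbove S
  · obtain ⟨b, hb⟩ := hb
    obtain ⟨m, hm, hmax⟩ := Int.exists_greatest_of_bdd (P := fun z => z ∈ S)
      ⟨b, fun z hz => hb hz⟩ hne
    have h1 : ∀ k, S.indicator (fun k : ℤ => (2 : ℝ≥0∞) ^ (s * k)) k ≤
        2 ^ (-(s * |(k : ℝ) - m|)) * M := fun k => by
      by_cases hk : k ∈ S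
      · rw [indicator_of_mem hk]
        have : (k : ℝ) ≤ m := by exact_mod_cast hmax k hk
        have e : s * (k : ℝ) = -(s * |(k : ℝ) - m|) + s * m := by
          rw [abs_of_nonpos (by linarith)]; ring
        rw [e, two_rpow_add]
        gcongr
        exact h m hm
      · rw [indicator_of_notMem hk]; exact zero_le
    refine (ENNReal.tsum_le_tsum h1).trans (le_of_eq ?_)
    rw [ENNReal.tsum_mul_right, tsum_two_rpow_dist]
  -- For S unbounded above the terms are unbounded.
  · have : M = ∞ := by
      by_contra hM
      obtain ⟨m, hm⟩ := ENNReal.exists_nat_gt hM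
      rw [not_bddAbove_iff] at hb
      obtain ⟨k, hk, hmk⟩ := hb ⌈(m : ℝ) / s⌉
      have h2 : (m : ℝ) ≤ s * k := by
        have : (m : ℝ) / s ≤ k := (Int.le_ceil _).trans (by exact_mod_cast hmk.le)
        rwa [div_le_iff₀' hs] at this
      have h3 : (m : ℝ≥0∞) ≤ 2 ^ (s * (k : ℝ)) := by
        refine le_trans ?_ (two_rpow_le h2)
        rw [ENNReal.rpow_natCast]
        exact_mod_cast (Nat.lt_two_pow_self (n := m)).le
      exact absurd ((h k hk).trans_lt hm) (not_lt.2 h3)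
    rw [this, ENNReal.mul_top (one_pos.trans_le (one_le_geomSum s)).ne']
    exact le_top

/-- Hölder's inequality for series, with `1/p = 1/s + 1/t`. -/
theorem tsum_mul_rpow_le {p s t : ℝ} (hp : 0 < p) (hs : 0 < s) (ht : 0 < t)
    (h : 1 / s + 1 / t = 1 / p) (x y : ℤ → ℝ≥0∞) :
    (∑' k, (x k * y k) ^ p) ^ (1 / p) ≤
      (∑' k, x k ^ s) ^ (1 / s) * (∑' k, y k ^ t) ^ (1 / t) := by
  have hc : (s / p).HolderConjugate (t / p) := by
    constructor
    · field_simp at h ⊢; linarith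
    · positivity
    · positivity
  have := ENNReal.lintegral_mul_le_Lp_mul_Lq (Measure.count : Measure ℤ) hc
    (f := fun k => x k ^ p) (g := fun k => y k ^ p)
    (measurable_of_countable _).aemeasurable (measurable_of_countable _).aemeasurable
  simp only [lintegral_count, Pi.mul_apply, ← ENNReal.rpow_mul] at this
  rw [mul_div_cancel₀ _ hp.ne', mul_div_cancel₀ _ hp.ne'] at this
  calc _ = (∑' k, x k ^ p * y k ^ p) ^ (1 / p) := by
        simp_rw [ENNReal.mul_rpow_of_nonneg _ _ hp.le]
    _ ≤ _ := ENNReal.rpow_le_rpow this (by positivity)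
    _ = _ := by
      rw [ENNReal.mul_rpow_of_nonneg _ _ (by positivity), ← ENNReal.rpow_mul, ← ENNReal.rpow_mul]
      congr 2 <;> field_simp

/-- The embedding `ℓ^t ⊆ ℓ^p` for `t ≤ p`. -/
theorem tsum_rpow_le_tsum_rpow {p t : ℝ} (ht : 0 < t) (h : t ≤ p) (x : ℤ → ℝ≥0∞) :
    (∑' k, x k ^ p) ^ (1 / p) ≤ (∑' k, x k ^ t) ^ (1 / t) := by
  have hp : 0 < p := ht.trans_le h
  set S := ∑' k, x k ^ t
  have hx : ∀ k, x k ≤ S ^ (1 / t) := fun k => by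
    rw [one_div, ENNReal.le_rpow_inv_iff ht]; exact ENNReal.le_tsum k
  rw [one_div, ENNReal.rpow_inv_le_iff hp, ← ENNReal.rpow_mul]
  calc ∑' k, x k ^ p ≤ ∑' k, x k ^ t * (S ^ (1 / t)) ^ (p - t) := by
        refine ENNReal.tsum_le_tsum fun k => ?_
        calc x k ^ p = x k ^ (t + (p - t)) := by ring_nf
          _ = x k ^ t * x k ^ (p - t) :=
            ENNReal.rpow_add_of_nonneg _ _ ht.le (by linarith)
          _ ≤ _ := by gcongr; exact hx k
    _ = S * S ^ (1 / t * (p - t)) := by rw [ENNReal.tsum_mul_right, ← ENNReal.rpow_mul]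
    _ = S ^ (1 + 1 / t * (p - t)) := by
        rw [ENNReal.rpow_add_of_nonneg _ _ (by norm_num)
          (mul_nonneg (by positivity) (by linarith)), ENNReal.rpow_one]
    _ ≤ _ := le_of_eq (by congr 1; field_simp; ring)

/-! ### Reduction of monotone unions over the reals to countable ones. -/

section Order

/-- A countable dense subset of S does the job except at a least or a greatest element of S, which
it may miss. These at most two points are added. -/
theorem exists_countable_cofinal_coinitial (S : Set ℝ) :
    ∃ D ⊆ S, D.Countable ∧ ∀ t ∈ S, (∃ d ∈ D, d ≤ t) ∧ ∃ d ∈ D, t ≤ d := by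
  obtain ⟨D, hD, hd⟩ := TopologicalSpace.exists_countable_dense S
  have h1 : {t | IsLeast S t}.Subsingleton := fun a ha b hb => ha.unique hb
  have h2 : {t | IsGreatest S t}.Subsingleton := fun a ha b hb => ha.unique hb
  refine ⟨(↑) '' D ∪ ({t | IsLeast S t} ∪ {t | IsGreatest S t}), ?_,
    (hD.image _).union (h1.countable.union h2.countable), fun t ht => ⟨?_, ?_⟩⟩
  · rintro x (⟨y, -, rfl⟩ | hx | hx)
    exacts [y.2, hx.1, hx.1]
  · by_cases h : IsLeast S t
    · exact ⟨t, Or.inr (Or.inl h), le_rfl⟩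
    · have : ∃ r ∈ S, r < t := by
        by_contra! hc; exact h ⟨ht, hc⟩
      obtain ⟨r, hr, hrt⟩ := this
      obtain ⟨d, hdt, hdD⟩ := hd.inter_open_nonempty {x : S | (x : ℝ) < t}
        (isOpen_Iio.preimage continuous_subtype_val) ⟨⟨r, hr⟩, hrt⟩
      exact ⟨d, Or.inl ⟨d, hdD, rfl⟩, le_of_lt hdt⟩
  · by_cases h : IsGreatest S t
    · exact ⟨t, Or.inr (Or.inr h), le_rfl⟩
    · have : ∃ r ∈ S, t < r := by
        by_contra! hc; exact h ⟨ht, hc⟩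
      obtain ⟨r, hr, hrt⟩ := this
      obtain ⟨d, hdt, hdD⟩ := hd.inter_open_nonempty {x : S | t < (x : ℝ)}
        (isOpen_Ioi.preimage continuous_subtype_val) ⟨⟨r, hr⟩, hrt⟩
      exact ⟨d, Or.inl ⟨d, hdD, rfl⟩, le_of_lt hdt⟩

/-- A monotone or antitone union over a set of reals is a countable directed union. -/
theorem exists_countable_directed_iUnion {α : Type*} {A : ℝ → Set α}
    (hA : Monotone A ∨ Antitone A) (S : Set ℝ) :
    ∃ D ⊆ S, D.Countable ∧ Directed (· ⊆ ·) (fun d : D => A d) ∧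
      ⋃ t ∈ S, A t = ⋃ d : D, A d := by
  obtain ⟨D, hDS, hD, hc⟩ := exists_countable_cofinal_coinitial S
  refine ⟨D, hDS, hD, ?_, ?_⟩
  · rcases hA with hA | hA
    · exact directed_of_isDirected_le fun a b hab => hA hab
    · exact directed_of_isDirected_ge fun a b hab => hA hab
  · refine subset_antisymm (iUnion₂_subset fun t ht => ?_)
      (iUnion_subset fun d => subset_biUnion_of_mem (u := A) (hDS d.2))
    obtain ⟨⟨d, hd, h⟩, d', hd', h'⟩ := hc t ht
    rcases hA with hA | hA
    · exact (hA h').trans (subset_iUnion (fun d : D => A d) ⟨d', hd'⟩)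
    · exact (hA h).trans (subset_iUnion (fun d : D => A d) ⟨d, hd⟩)

theorem measure_biUnion_le {α : Type*} [MeasurableSpace α] (μ : Measure α) {A : ℝ → Set α}
    (hA : Monotone A ∨ Antitone A) {S : Set ℝ} {B : ℝ≥0∞} (h : ∀ t ∈ S, μ (A t) ≤ B) :
    μ (⋃ t ∈ S, A t) ≤ B := by
  obtain ⟨D, hDS, hD, hdir, he⟩ := exists_countable_directed_iUnion hA S
  have := hD.to_subtype
  rw [he, hdir.measure_iUnion]
  exact iSup_le fun d => h d (hDS d.2)

end Order

/-! ### The weighted functionals and their behaviour under unions. -/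

section WNorm

variable {α : Type*} [MeasureSpace α] {p : ℝ≥0∞} {A B : Set α} {w f g : α → ℝ≥0∞}

theorem wNorm_of_ne_top (hp : p ≠ ∞) :
    wNorm p A w f = (∫⁻ x in A, f x ^ p.toReal * w x) ^ (1 / p.toReal) := if_neg hp

theorem wNorm_top : wNorm ∞ A w f = essSup (fun x => f x * w x) (volume.restrict A) := if_pos rfl

theorem wNorm_rpow (hp0 : p ≠ 0) (hp : p ≠ ∞) :
    wNorm p A w f ^ p.toReal = ∫⁻ x in A, f x ^ p.toReal * w x := by
  rw [wNorm_of_ne_top hp, one_div, ENNReal.rpow_inv_rpow (ENNReal.toReal_pos hp0 hp).ne']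

theorem uNorm_of_ne_top (hp : p ≠ ∞) :
    uNorm p A f = (∫⁻ x in A, f x ^ p.toReal) ^ (1 / p.toReal) := by
  simp [uNorm, wNorm_of_ne_top hp]

theorem uNorm_rpow (hp0 : p ≠ 0) (hp : p ≠ ∞) :
    uNorm p A f ^ p.toReal = ∫⁻ x in A, f x ^ p.toReal := by
  simp [uNorm, wNorm_rpow hp0 hp]

theorem uNorm_top : uNorm ∞ A f = essSup f (volume.restrict A) := by
  simp [uNorm, wNorm_top]

theorem wNorm_mono_ae_set (h : A ≤ᵐ[volume] B) : wNorm p A w f ≤ wNorm p B w f := by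
  have hsub : (volume : Measure α).restrict A ≤ volume.restrict B := Measure.restrict_mono_ae h
  unfold wNorm
  split_ifs with hp
  · exact essSup_mono_measure (Measure.absolutelyContinuous_of_le hsub)
  · exact ENNReal.rpow_le_rpow (lintegral_mono' hsub le_rfl) (by positivity)

theorem wNorm_mono_set (h : A ⊆ B) : wNorm p A w f ≤ wNorm p B w f :=
  wNorm_mono_ae_set h.eventuallyLE

theorem wNorm_mono (h : ∀ᵐ x ∂volume.restrict A, f x ≤ g x) : wNorm p A w f ≤ wNorm p A w g := by
  unfold wNorm
  split_ifs with hp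
  · exact essSup_mono_ae (h.mono fun x hx => by dsimp only; gcongr)
  · refine ENNReal.rpow_le_rpow (lintegral_mono_ae (h.mono fun x hx => ?_)) (by positivity)
    gcongr

theorem wNorm_const_mul (hp : 0 < p) {c : ℝ≥0∞} (hc : c ≠ ∞) :
    wNorm p A w (fun x => c * f x) = c * wNorm p A w f := by
  by_cases h : p = ∞
  · subst h; simp only [wNorm_top, mul_assoc, ENNReal.essSup_const_mul]
  · have hr := ENNReal.toReal_pos hp.ne' h
    simp only [wNorm_of_ne_top h, ENNReal.mul_rpow_of_nonneg _ _ hr.le, mul_assoc]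
    rw [lintegral_const_mul' _ _ (ENNReal.rpow_ne_top_of_nonneg hr.le hc),
      ENNReal.mul_rpow_of_nonneg _ _ (by positivity), one_div, ENNReal.rpow_rpow_inv hr.ne']

/-- Monotone convergence for p < ∞; for p = ∞ a countable union of null sets is null. -/
theorem wNorm_iUnion_le {ι : Type*} [Countable ι] {A : ι → Set α} (hA : Directed (· ⊆ ·) A)
    {C : ℝ≥0∞} (hp : 0 < p) (h : ∀ i, wNorm p (A i) w f ≤ C) : wNorm p (⋃ i, A i) w f ≤ C := by
  by_cases hp' : p = ∞
  · subst hp'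
    rw [wNorm_top]
    refine essSup_le_of_ae_le _ ?_
    rw [Filter.EventuallyLE, ae_restrict_iUnion_iff]
    intro i
    refine (ENNReal.ae_le_essSup _).mono fun x hx => hx.trans ?_
    simpa [wNorm_top] using h i
  · have hr := ENNReal.toReal_pos hp.ne' hp'
    rw [wNorm_of_ne_top hp', one_div, ENNReal.rpow_inv_le_iff hr,
      setLIntegral_iUnion_of_directed _ hA]
    refine iSup_le fun i => ?_
    rw [← wNorm_rpow hp.ne' hp']
    exact ENNReal.rpow_le_rpow (h i) hr.le

theorem wNorm_biUnion_le {A : ℝ → Set α} (hA : Monotone A ∨ Antitone A) {S : Set ℝ}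
    {C : ℝ≥0∞} (hp : 0 < p) (h : ∀ t ∈ S, wNorm p (A t) w f ≤ C) :
    wNorm p (⋃ t ∈ S, A t) w f ≤ C := by
  obtain ⟨D, hDS, hD, hdir, he⟩ := exists_countable_directed_iUnion hA S
  have := hD.to_subtype
  rw [he]
  exact wNorm_iUnion_le hdir hp fun d => h d (hDS d.2)

/-- The constant of `wNorm_le_of_iUnion`. -/
def unionConst (p : ℝ≥0∞) : ℝ≥0∞ := geomSum (p.toReal / 2) ^ (1 / p.toReal)

theorem unionConst_ne_top (hp : 0 < p) : unionConst p ≠ ∞ := by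
  by_cases h : p = ∞
  -- Here `geomSum 0` is infinite, but the exponent `1 / 0 = 0` makes the constant `1`.
  · simp [unionConst, h]
  · have := ENNReal.toReal_pos hp.ne' h
    exact ENNReal.rpow_ne_top_of_nonneg (by positivity) (geomSum_ne_top (by positivity))

theorem one_le_unionConst : 1 ≤ unionConst p := by
  simpa [unionConst] using
    ENNReal.rpow_le_rpow (one_le_geomSum (p.toReal / 2)) (by positivity : 0 ≤ 1 / p.toReal)

/-- The p-th powers of the pieces form a geometric series around the index k. This replaces the
triangle inequality for infinitely many pieces, uniformly in p, including p < 1. -/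
theorem wNorm_le_of_iUnion (hp : 0 < p) {A : ℤ → Set α} (hB : B ≤ᵐ[volume] ⋃ j, A j) (k : ℤ)
    {M : ℝ≥0∞} (h : ∀ j, wNorm p (A j) w f ≤ 2 ^ (-(1 / 2 * |(j : ℝ) - k|)) * M) :
    wNorm p B w f ≤ unionConst p * M := by
  refine (wNorm_mono_ae_set hB).trans ?_
  by_cases hp' : p = ∞
  · subst hp'
    rw [wNorm_top]
    refine essSup_le_of_ae_le _ ?_
    rw [Filter.EventuallyLE, ae_restrict_iUnion_iff]
    intro i
    refine (ENNReal.ae_le_essSup _).mono fun x hx => hx.trans ?_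
    rw [← wNorm_top]
    refine (h i).trans ?_
    gcongr
    refine le_trans ?_ one_le_unionConst
    calc (2 : ℝ≥0∞) ^ (-(1 / 2 * |(i : ℝ) - k|)) ≤ 2 ^ (0 : ℝ) :=
        two_rpow_le (by have := abs_nonneg ((i : ℝ) - k); linarith)
      _ = 1 := by simp
  · have hr := ENNReal.toReal_pos hp.ne' hp'
    rw [wNorm_of_ne_top hp', one_div, ENNReal.rpow_inv_le_iff hr]
    refine (lintegral_iUnion_le _ _).trans ?_
    calc _ ≤ ∑' j : ℤ, (2 : ℝ≥0∞) ^ (-(p.toReal / 2 * |(j : ℝ) - k|)) * M ^ p.toReal := by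
          refine ENNReal.tsum_le_tsum fun j => ?_
          rw [← wNorm_rpow hp.ne' hp']
          refine (ENNReal.rpow_le_rpow (h j) hr.le).trans (le_of_eq ?_)
          rw [ENNReal.mul_rpow_of_nonneg _ _ hr.le, ← ENNReal.rpow_mul]
          ring_nf
      _ = geomSum (p.toReal / 2) * M ^ p.toReal := by
          rw [ENNReal.tsum_mul_right, tsum_two_rpow_dist]
      _ = _ := by
          rw [ENNReal.mul_rpow_of_nonneg _ _ hr.le, unionConst, one_div,
            ENNReal.rpow_inv_rpow hr.ne']

end WNorm

/-! ### The exponent with reciprocal 1/p - 1/q. -/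

section GapExp

variable {p q : ℝ≥0∞}

theorem gapExp_inv : (gapExp p q)⁻¹ = p⁻¹ - q⁻¹ := inv_inv _

theorem gapExp_pos (hp : 0 < p) : 0 < gapExp p q :=
  ENNReal.inv_pos.2 (ne_top_of_le_ne_top (ENNReal.inv_ne_top.2 hp.ne') tsub_le_self)

theorem gapExp_ne_top (h : p < q) : gapExp p q ≠ ∞ :=
  ENNReal.inv_ne_top.2 (tsub_pos_of_lt (ENNReal.inv_lt_inv.2 h)).ne'

/-- The endpoints are covered: for p = q both sides vanish because `∞.toReal = 0` and `1 / 0 = 0`.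
-/
theorem one_div_gapExp_toReal (hp : 0 < p) (h : p ≤ q) :
    1 / (gapExp p q).toReal = 1 / p.toReal - (q⁻¹).toReal := by
  rw [one_div, ← ENNReal.toReal_inv, gapExp_inv,
    ENNReal.toReal_sub_of_le (ENNReal.inv_le_inv.2 h) (ENNReal.inv_ne_top.2 hp.ne'),
    ENNReal.toReal_inv, one_div]

end GapExp

/-! ### Hölder's inequality between the two weighted spaces and its sharpness. -/

section Holder

variable {n : ℕ} {p₁ p₂ : ℝ≥0∞} {v₁ v₂ : Rn n → ℝ≥0∞} {A : Set (Rn n)}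

/-- The function `v₁^{1/p₁} v₂^{-1/p₂}`. -/
def ratio (p₁ p₂ : ℝ≥0∞) (v₁ v₂ : Rn n → ℝ≥0∞) (x : Rn n) : ℝ≥0∞ :=
  v₁ x ^ (1 / p₁.toReal) * v₂ x ^ (-(1 / p₂.toReal))

theorem ratioNorm_eq : ratioNorm p₁ p₂ v₁ v₂ A = uNorm (gapExp p₁ p₂) A (ratio p₁ p₂ v₁ v₂) := rfl

theorem aemeasurable_ratio (hv₁ : IsWeight v₁) (hv₂ : IsWeight v₂) :
    AEMeasurable (ratio p₁ p₂ v₁ v₂) :=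
  (hv₁.1.pow_const _).mul (hv₂.1.pow_const _)

/-- The powers of b cancel. With a = v₁ and b = v₂ this is the pointwise factorization behind both
Hölder's inequality and the test functions. -/
theorem rpow_mul_weight_eq {p q : ℝ} (hp : 0 < p) (hq : 0 < q) {a b : ℝ≥0∞} (hb0 : b ≠ 0)
    (hb : b ≠ ∞) (y : ℝ≥0∞) :
    y ^ p * a = (y ^ q * b) ^ (p / q) * (a ^ (1 / p) * b ^ (-(1 / q))) ^ p := by
  rw [ENNReal.mul_rpow_of_nonneg _ _ (by positivity), ENNReal.mul_rpow_of_nonneg _ _ hp.le,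
    ← ENNReal.rpow_mul, ← ENNReal.rpow_mul, ← ENNReal.rpow_mul, mul_div_cancel₀ _ hq.ne',
    one_div_mul_cancel hp.ne', ENNReal.rpow_one]
  have : b ^ (p / q) * b ^ (-(1 / q) * p) = 1 := by
    rw [← ENNReal.rpow_add _ _ hb0 hb]
    have : p / q + -(1 / q) * p = 0 := by ring
    rw [this, ENNReal.rpow_zero]
  calc y ^ p * a = y ^ p * a * (b ^ (p / q) * b ^ (-(1 / q) * p)) := by rw [this, mul_one]
    _ = _ := by ring

/-- Hölder with exponents p₂/p₁ and σ/p₁ after the pointwise factorization; for p₁ = p₂ the ratio is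
replaced by its essential supremum. -/
theorem wNorm_le_ratioNorm_mul (hp₁ : 0 < p₁) (hp : p₁ ≤ p₂) (hp₂ : p₂ < ∞) (hv₁ : IsWeight v₁)
    (hv₂ : IsWeight v₂) {g : Rn n → ℝ≥0∞} (hg : AEMeasurable g) :
    wNorm p₁ A v₁ g ≤ ratioNorm p₁ p₂ v₁ v₂ A * wNorm p₂ A v₂ g := by
  have h1t : p₁ ≠ ∞ := (hp.trans_lt hp₂).ne
  have hp' : 0 < p₁.toReal := ENNReal.toReal_pos hp₁.ne' h1t
  have hq' : 0 < p₂.toReal := ENNReal.toReal_pos (hp₁.trans_le hp).ne' hp₂.ne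
  have key : ∫⁻ x in A, g x ^ p₁.toReal * v₁ x = ∫⁻ x in A,
      (g x ^ p₂.toReal * v₂ x) ^ (p₁.toReal / p₂.toReal) * ratio p₁ p₂ v₁ v₂ x ^ p₁.toReal := by
    refine lintegral_congr_ae (ae_restrict_of_ae (hv₂.2.mono fun x hx => ?_))
    exact rpow_mul_weight_eq hp' hq' hx.1.ne' hx.2.ne _
  have hW := (aemeasurable_ratio (p₁ := p₁) (p₂ := p₂) hv₁ hv₂).restrict (s := A)
  have hG : AEMeasurable (fun x => g x ^ p₂.toReal * v₂ x) (volume.restrict A) :=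
    ((hg.pow_const _).mul hv₂.1).restrict
  rw [ratioNorm_eq, wNorm_of_ne_top h1t, key, one_div, ENNReal.rpow_inv_le_iff hp',
    ENNReal.mul_rpow_of_nonneg _ _ hp'.le]
  rcases hp.eq_or_lt with rfl | hlt
  · rw [gapExp_self, uNorm_top, wNorm_rpow hp₁.ne' h1t, ← lintegral_const_mul'' _ hG]
    refine lintegral_mono_ae
      ((ENNReal.ae_le_essSup (ratio p₁ p₁ v₁ v₂)).mono fun x hx => ?_)
    rw [div_self hp'.ne', ENNReal.rpow_one, mul_comm]
    gcongr
  · have hσ : 0 < (gapExp p₁ p₂).toReal :=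
      ENNReal.toReal_pos (gapExp_pos hp₁).ne' (gapExp_ne_top hlt)
    have h1 := one_div_gapExp_toReal hp₁ hp
    rw [ENNReal.toReal_inv] at h1
    set σ := (gapExp p₁ p₂).toReal with hσdef
    set p := p₁.toReal
    set q := p₂.toReal with hqdef
    have hc : (q / p).HolderConjugate (σ / p) := by
      constructor
      · have : p * (1 / σ) + p * q⁻¹ = 1 := by rw [h1]; field_simp; ring
        rw [inv_one, inv_div, inv_div, ← this]; ring
      · positivity
      · positivity
    have := ENNReal.lintegral_mul_le_Lp_mul_Lq (volume.restrict A) hc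
      (hG.pow_const (p / q)) (hW.pow_const p)
    simp only [Pi.mul_apply, ← ENNReal.rpow_mul] at this
    rw [div_mul_div_cancel₀ hq'.ne', div_self hp'.ne', mul_div_cancel₀ _ hp'.ne'] at this
    refine this.trans (le_of_eq ?_)
    rw [uNorm_of_ne_top (gapExp_ne_top hlt), wNorm_of_ne_top hp₂.ne, ← ENNReal.rpow_mul,
      ← ENNReal.rpow_mul, mul_comm]
    simp only [ENNReal.rpow_one, ← hσdef, ← hqdef]
    congr 2 <;> field_simp

/-- Take f = (u/(I v₂))^{1/p₂} on A with I = ∫_A u, so that f^{p₂} v₂ = u/I has integral 1. Then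
`hm` is the required lower bound multiplied by I^{p₁/p₂}. -/
theorem exists_test_of_density (hp₁ : 0 < p₁) (hp : p₁ ≤ p₂) (hp₂ : p₂ < ∞)
    (hv₂ : IsWeight v₂) (hA : MeasurableSet A) {m : ℝ≥0∞} {u : Rn n → ℝ≥0} (hu : Measurable u)
    (hu0 : ∫⁻ x in A, u x ≠ 0) (hu1 : ∫⁻ x in A, u x ≠ ∞)
    (hm : m ^ p₁.toReal * (∫⁻ x in A, u x) ^ (p₁.toReal / p₂.toReal) ≤
      ∫⁻ x in A, (u x : ℝ≥0∞) ^ (p₁.toReal / p₂.toReal) * ratio p₁ p₂ v₁ v₂ x ^ p₁.toReal) :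
    ∃ f : Rn n → ℝ, AEMeasurable f ∧ (∀ x ∉ A, f x = 0) ∧
      wNorm p₂ univ v₂ (fun x => ‖f x‖ₑ) ≤ 1 ∧ m ≤ wNorm p₁ A v₁ (fun x => ‖f x‖ₑ) := by
  have h1t : p₁ ≠ ∞ := (hp.trans_lt hp₂).ne
  have hp' : 0 < p₁.toReal := ENNReal.toReal_pos hp₁.ne' h1t
  have hq' : 0 < p₂.toReal := ENNReal.toReal_pos (hp₁.trans_le hp).ne' hp₂.ne
  set p := p₁.toReal
  set q := p₂.toReal
  set I := ∫⁻ x in A, u x with hI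
  set φ : Rn n → ℝ≥0∞ := fun x => ((u x : ℝ≥0∞) / I / v₂ x) ^ (1 / q)
  have hφm : AEMeasurable φ :=
    ((hu.coe_nnreal_ennreal.aemeasurable.div_const I).div hv₂.1).pow_const _
  have hφ : ∀ᵐ x, x ∈ A → ‖A.indicator (fun x => (φ x).toReal) x‖ₑ ^ q * v₂ x = u x / I := by
    refine hv₂.2.mono fun x hx hxA => ?_
    have hfin : (u x : ℝ≥0∞) / I / v₂ x ≠ ∞ :=
      ENNReal.div_ne_top (ENNReal.div_ne_top ENNReal.coe_ne_top hu0) hx.1.ne'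
    rw [indicator_of_mem hxA, Real.enorm_eq_ofReal ENNReal.toReal_nonneg, ENNReal.ofReal_toReal
      (ENNReal.rpow_ne_top_of_nonneg (by positivity) hfin)]
    rw [one_div,
      ENNReal.rpow_inv_rpow hq'.ne', ENNReal.div_mul_cancel hx.1.ne' hx.2.ne]
  refine ⟨A.indicator fun x => (φ x).toReal, hφm.ennreal_toReal.indicator hA,
    fun x hx => indicator_of_notMem hx _, ?_, ?_⟩
  · rw [wNorm_of_ne_top hp₂.ne, one_div, ENNReal.rpow_inv_le_iff hq', ENNReal.one_rpow,
      Measure.restrict_univ]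
    have : ∫⁻ x, ‖A.indicator (fun x => (φ x).toReal) x‖ₑ ^ q * v₂ x =
        ∫⁻ x in A, u x / I := by
      rw [← lintegral_indicator hA]
      refine lintegral_congr_ae (hφ.mono fun x hx => ?_)
      by_cases hxA : x ∈ A
      · exact (hx hxA).trans (indicator_of_mem hxA fun x => (u x : ℝ≥0∞) / I).symm
      · simp [hxA, ENNReal.zero_rpow_of_pos hq']
    rw [this]
    simp only [div_eq_mul_inv]
    rw [lintegral_mul_const _ hu.coe_nnreal_ennreal, ← hI, ENNReal.mul_inv_cancel hu0 hu1]
  · rw [wNorm_of_ne_top h1t, one_div, ENNReal.le_rpow_inv_iff hp']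
    have : ∫⁻ x in A, ‖A.indicator (fun x => (φ x).toReal) x‖ₑ ^ p * v₁ x =
        ∫⁻ x in A, (u x / I) ^ (p / q) * ratio p₁ p₂ v₁ v₂ x ^ p := by
      refine setLIntegral_congr_fun_ae hA ?_
      filter_upwards [hφ, hv₂.2] with x hx hx2 hxA
      rw [rpow_mul_weight_eq hp' hq' hx2.1.ne' hx2.2.ne, hx hxA]
      rfl
    rw [this]
    simp only [div_eq_mul_inv (G := ℝ≥0∞), ENNReal.mul_rpow_of_nonneg _ _
      (by positivity : 0 ≤ p / q)]
    have hI' : I⁻¹ ^ (p / q) ≠ ∞ :=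
      ENNReal.rpow_ne_top_of_nonneg (by positivity) (ENNReal.inv_ne_top.2 hu0)
    calc m ^ p = I⁻¹ ^ (p / q) * (m ^ p * I ^ (p / q)) := by
          rw [mul_left_comm, ← ENNReal.mul_rpow_of_nonneg _ _ (by positivity),
            ENNReal.inv_mul_cancel hu0 hu1, ENNReal.one_rpow, mul_one]
      _ ≤ I⁻¹ ^ (p / q) * ∫⁻ x in A, (u x : ℝ≥0∞) ^ (p / q) * ratio p₁ p₂ v₁ v₂ x ^ p := by
          gcongr
      _ = _ := by
          rw [← lintegral_const_mul' _ _ hI']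
          congr 1; ext x; ring

/-- Duality between `L_{p₂}(v₂)` and `L_{p₁}(v₁)`: almost extremal functions. -/
theorem exists_test (hp₁ : 0 < p₁) (hp : p₁ ≤ p₂) (hp₂ : p₂ < ∞) (hv₁ : IsWeight v₁)
    (hv₂ : IsWeight v₂) (hA : MeasurableSet A) {m : ℝ≥0∞}
    (hm : m < ratioNorm p₁ p₂ v₁ v₂ A ∨ m = 0) :
    ∃ f : Rn n → ℝ, AEMeasurable f ∧ (∀ x ∉ A, f x = 0) ∧
      wNorm p₂ univ v₂ (fun x => ‖f x‖ₑ) ≤ 1 ∧ m ≤ wNorm p₁ A v₁ (fun x => ‖f x‖ₑ) := by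
  have h1t : p₁ ≠ ∞ := (hp.trans_lt hp₂).ne
  have hp' : 0 < p₁.toReal := ENNReal.toReal_pos hp₁.ne' h1t
  have hq' : 0 < p₂.toReal := ENNReal.toReal_pos (hp₁.trans_le hp).ne' hp₂.ne
  rcases hm with hm | rfl
  swap
  · refine ⟨fun _ => 0, aemeasurable_const, fun _ _ => rfl, ?_, zero_le⟩
    rw [wNorm_of_ne_top hp₂.ne]
    simp [ENNReal.zero_rpow_of_pos hq', ENNReal.zero_rpow_of_pos (inv_pos.2 hq')]
  have hW := (aemeasurable_ratio (p₁ := p₁) (p₂ := p₂) hv₁ hv₂).restrict (s := A)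
  rw [ratioNorm_eq] at hm
  rcases hp.eq_or_lt with rfl | hlt
  · rw [gapExp_self, uNorm_top] at hm
    set W := ratio p₁ p₁ v₁ v₂
    -- The set where W exceeds m is not null but may have infinite measure. A simple function below
    -- its indicator with positive finite integral serves as the density.
    have hpos : 0 < ∫⁻ x in A, (({x | m < W x}.indicator 1 x : ℝ≥0) : ℝ≥0∞) := by
      have e : ∀ x, (({x | m < W x}.indicator 1 x : ℝ≥0) : ℝ≥0∞) =
          {x | m < W x}.indicator 1 x := fun x => by
        by_cases h : x ∈ {x | m < W x} <;> simp only [h, indicator_of_mem, indicator_of_notMem,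
          not_false_eq_true, Pi.one_apply, ENNReal.coe_one, ENNReal.coe_zero]
      simp only [e]
      rw [lintegral_indicator_one₀ (nullMeasurableSet_lt aemeasurable_const hW), pos_iff_ne_zero]
      intro h0
      refine absurd hm (not_lt.2 (essSup_le_of_ae_le _ ?_))
      rw [Filter.EventuallyLE, ae_iff]
      simpa using h0
    obtain ⟨u, hu, hut, hu0⟩ := exists_lt_lintegral_simpleFunc_of_lt_lintegral hpos
    refine exists_test_of_density hp₁ hp hp₂ hv₂ hA u.measurable hu0.ne' hut.ne ?_
    simp only [div_self hp'.ne', ENNReal.rpow_one]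
    rw [← lintegral_const_mul _ u.measurable.coe_nnreal_ennreal]
    refine lintegral_mono fun x => ?_
    by_cases h : m < W x
    · rw [mul_comm]; gcongr
    · have : u x = 0 := by simpa [h] using hu x
      simp [this]
  · have hσ : 0 < (gapExp p₁ p₂).toReal :=
      ENNReal.toReal_pos (gapExp_pos hp₁).ne' (gapExp_ne_top hlt)
    have h1 := one_div_gapExp_toReal hp₁ hp
    rw [ENNReal.toReal_inv] at h1
    rw [uNorm_of_ne_top (gapExp_ne_top hlt), one_div, ENNReal.lt_rpow_inv_iff hσ] at hm
    set σ := (gapExp p₁ p₂).toReal with hσdef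
    set W := ratio p₁ p₂ v₁ v₂ with hWdef
    have hfin : ∀ᵐ x, W x ≠ ∞ := by
      filter_upwards [hv₁.2, hv₂.2] with x h1 h2
      exact ENNReal.mul_ne_top (ENNReal.rpow_ne_top_of_nonneg (by positivity) h1.2.ne)
        (ENNReal.rpow_ne_top_of_ne_zero h2.1.ne' h2.2.ne)
    have e : ∫⁻ x in A, W x ^ σ = ∫⁻ x in A, ((W x ^ σ).toNNReal : ℝ≥0∞) :=
      lintegral_congr_ae (ae_restrict_of_ae (hfin.mono fun x hx =>
        (ENNReal.coe_toNNReal (ENNReal.rpow_ne_top_of_nonneg hσ.le hx)).symm))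
    rw [e] at hm
    -- The extremal density would be W^σ; a simple u below it keeps the integral above m^σ and
    -- finite.
    obtain ⟨u, hu, hut, hu0⟩ := exists_lt_lintegral_simpleFunc_of_lt_lintegral hm
    have hu0' := (zero_le.trans_lt hu0).ne'
    refine exists_test_of_density hp₁ hp hp₂ hv₂ hA u.measurable hu0' hut.ne ?_
    set p := p₁.toReal
    set q := p₂.toReal
    have hexp : p / σ + p / q = 1 := by
      have : p * (1 / σ) + p * q⁻¹ = 1 := by rw [h1]; field_simp; ring
      rw [← this]; ring
    calc m ^ p * (∫⁻ x in A, u x) ^ (p / q) = (m ^ σ) ^ (p / σ) * (∫⁻ x in A, u x) ^ (p / q) := by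
          rw [← ENNReal.rpow_mul, mul_div_cancel₀ _ hσ.ne']
      _ ≤ (∫⁻ x in A, u x) ^ (p / σ) * (∫⁻ x in A, u x) ^ (p / q) := by gcongr
      _ = ∫⁻ x in A, u x := by
          rw [← ENNReal.rpow_add _ _ hu0' hut.ne, hexp, ENNReal.rpow_one]
      _ ≤ _ := by
          refine lintegral_mono fun x => ?_
          have hx : (u x : ℝ≥0∞) ≤ W x ^ σ :=
            (ENNReal.coe_le_coe.2 (hu x)).trans ENNReal.coe_toNNReal_le_self
          calc (u x : ℝ≥0∞) = (u x : ℝ≥0∞) ^ (p / q + p / σ) := by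
                rw [add_comm, hexp, ENNReal.rpow_one]
            _ = (u x : ℝ≥0∞) ^ (p / q) * (u x : ℝ≥0∞) ^ (p / σ) :=
                ENNReal.rpow_add_of_nonneg _ _ (by positivity) (by positivity)
            _ ≤ (u x : ℝ≥0∞) ^ (p / q) * (W x ^ σ) ^ (p / σ) := by gcongr
            _ = _ := by rw [← ENNReal.rpow_mul, mul_div_cancel₀ _ hσ.ne']

end Holder

/-! ### The tail of ω, its dyadic layers, and discretization of the Morrey norm. -/

section Tail

variable {θ : ℝ≥0∞} {ω : ℝ → ℝ≥0∞}

/-- Right continuity of the tail: (R,∞) is the increasing union of the (t,∞) with t > R. -/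
theorem tail_le_of_forall_gt (hθ : 0 < θ) {R : ℝ} {b : ℝ≥0∞} (h : ∀ t, R < t → tail θ ω t ≤ b) :
    tail θ ω R ≤ b := by
  have e : Ioi R = ⋃ t ∈ Ioi R, Ioi t := by
    ext x
    simp only [mem_iUnion, exists_prop, mem_Ioi]
    exact ⟨fun hx => exists_between hx, fun ⟨t, h1, h2⟩ => h1.trans h2⟩
  rw [tail, uNorm, e]
  exact wNorm_biUnion_le (Or.inr fun a b hab => Ioi_subset_Ioi hab) hθ fun t ht => h t ht

theorem exists_gt_lt_tail (hθ : 0 < θ) {R : ℝ} {b : ℝ≥0∞} (h : b < tail θ ω R) :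
    ∃ t, R < t ∧ b < tail θ ω t := by
  by_contra! hc
  exact absurd (tail_le_of_forall_gt hθ hc) (not_le.2 h)

/-- The set where `‖ω‖_{θ,(t,∞)} ≤ b`. -/
def sublevel (θ : ℝ≥0∞) (ω : ℝ → ℝ≥0∞) (b : ℝ≥0∞) : Set ℝ := {t | 0 < t ∧ tail θ ω t ≤ b}

/-- The set where `2^{-k-1} < ‖ω‖_{θ,(t,∞)} ≤ 2^{-k}`. -/
def layer (θ : ℝ≥0∞) (ω : ℝ → ℝ≥0∞) (k : ℤ) : Set ℝ :=
  {t | 0 < t ∧ tail θ ω t ∈ Ioc (dyadic (k + 1)) (dyadic k)}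

theorem measurable_tail : Measurable (tail θ ω) := (tail_antitone θ ω).measurable

theorem measurableSet_sublevel (b : ℝ≥0∞) : MeasurableSet (sublevel θ ω b) :=
  measurableSet_Ioi.inter (measurable_tail measurableSet_Iic)

theorem measurableSet_layer (k : ℤ) : MeasurableSet (layer θ ω k) :=
  measurableSet_Ioi.inter (measurable_tail measurableSet_Ioc)

theorem layer_subset_sublevel (k : ℤ) : layer θ ω k ⊆ sublevel θ ω (dyadic k) :=
  fun _ ht => ⟨ht.1, ht.2.2⟩

theorem layer_index_le {j k : ℤ} {r t : ℝ} (hr : r ∈ layer θ ω j) (ht : t ∈ layer θ ω k)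
    (h : r ≤ t) : j ≤ k :=
  Int.lt_add_one_iff.1 (lt_of_dyadic_lt
    (ht.2.1.trans_le ((tail_antitone θ ω h).trans hr.2.2)))

theorem layer_index_unique {j k : ℤ} {t : ℝ} (hj : t ∈ layer θ ω j) (hk : t ∈ layer θ ω k) :
    j = k :=
  le_antisymm (layer_index_le hj hk le_rfl) (layer_index_le hk hj le_rfl)

theorem pairwise_disjoint_layer : Pairwise (Function.onFun Disjoint (layer θ ω)) :=
  fun _ _ hjk => disjoint_left.2 fun _ hj hk => hjk (layer_index_unique hj hk)

theorem exists_mem_layer (hω : IsOmega θ ω) {t : ℝ} (ht : 0 < t) : ∃ k, t ∈ layer θ ω k := by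
  obtain ⟨k, hk⟩ := exists_dyadic (hω.2 t ht).1.ne' (hω.2 t ht).2.ne
  exact ⟨k, ht, hk⟩

theorem iUnion_layer (hω : IsOmega θ ω) : ⋃ k, layer θ ω k = Ioi 0 := by
  ext t
  simp only [mem_iUnion, mem_Ioi]
  exact ⟨fun ⟨k, hk⟩ => hk.1, exists_mem_layer hω⟩

/-- Up to at most one point, its least element, the sublevel set is covered by the half-lines (t,∞)
with t in it. -/
theorem uNorm_sublevel_le (hθ : 0 < θ) (b : ℝ≥0∞) : uNorm θ (sublevel θ ω b) ω ≤ b := by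
  have h : sublevel θ ω b ≤ᵐ[volume] (⋃ t ∈ sublevel θ ω b, Ioi t : Set ℝ) := by
    rw [ae_le_set]
    refine Set.Subsingleton.measure_zero (fun x hx y hy => ?_) _
    simp only [mem_sdiff, mem_iUnion, mem_Ioi, not_exists, not_lt] at hx hy
    exact le_antisymm (hx.2 y hy.1) (hy.2 x hx.1)
  exact (wNorm_mono_ae_set h).trans (wNorm_biUnion_le
    (Or.inr fun a b hab => Ioi_subset_Ioi hab) hθ fun t ht => ht.2)

/-- For θ < ∞ the tail comes from a measure without atoms and cannot jump over b. For d in D = {T >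
b}, the ω^θ-mass of (d,∞) exceeds b^θ and splits into its part in D and the sublevel set; the former
tends to 0 as d moves up through D. -/
theorem le_setLIntegral_sublevel (hθ : 0 < θ) (hθ' : θ ≠ ∞) (hω : IsOmega θ ω) {b : ℝ≥0∞}
    (hb : b < tail θ ω 0) :
    b ^ θ.toReal ≤ ∫⁻ r in sublevel θ ω b, ω r ^ θ.toReal := by
  have hr := ENNReal.toReal_pos hθ.ne' hθ'
  set μ : Measure ℝ := volume.withDensity fun r => ω r ^ θ.toReal
  have hμ : ∀ s, MeasurableSet s → μ s = ∫⁻ r in s, ω r ^ θ.toReal :=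
    fun s hs => withDensity_apply _ hs
  have hT : ∀ t, μ (Ioi t) = tail θ ω t ^ θ.toReal := fun t => by
    rw [hμ _ measurableSet_Ioi, tail, uNorm_rpow hθ.ne' hθ']
  set D : Set ℝ := {t | 0 < t ∧ b < tail θ ω t}
  have hDm : MeasurableSet D := measurableSet_Ioi.inter (measurable_tail measurableSet_Ioi)
  obtain ⟨t₀, ht₀⟩ : D.Nonempty := exists_gt_lt_tail hθ hb
  obtain ⟨D', hD', hc, hcof⟩ := exists_countable_cofinal_coinitial D
  have := hc.to_subtype
  obtain ⟨-, d₀, hd₀, -⟩ := hcof t₀ ht₀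
  have : Nonempty D' := ⟨⟨d₀, hd₀⟩⟩
  have hinter : μ (⋂ d : D', Ioi (d : ℝ) ∩ D) = ⨅ d : D', μ (Ioi (d : ℝ) ∩ D) := by
    refine Directed.measure_iInter
      (fun d => (measurableSet_Ioi.inter hDm).nullMeasurableSet)
      (directed_of_isDirected_le fun a c hac =>
        inter_subset_inter_left D (Ioi_subset_Ioi hac)) ⟨⟨d₀, hd₀⟩, ?_⟩
    refine ((measure_mono inter_subset_left).trans_lt ?_).ne
    rw [hT]
    exact ENNReal.rpow_lt_top_of_nonneg hr.le (hω.2 d₀ (hD' hd₀).1).2.ne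
  -- By right continuity of the tail, D has no greatest element.
  have hempty : (⋂ d : D', Ioi (d : ℝ) ∩ D) = ∅ := by
    rw [eq_empty_iff_forall_notMem]
    intro x hx
    rw [mem_iInter] at hx
    have hxD : x ∈ D := (hx ⟨d₀, hd₀⟩).2
    obtain ⟨y, hxy, hy⟩ := exists_gt_lt_tail hθ hxD.2
    obtain ⟨-, d, hd, hyd⟩ := hcof y ⟨hxD.1.trans hxy, hy⟩
    exact absurd ((hx ⟨d, hd⟩).1) (not_lt.2 (hxy.le.trans hyd))
  rw [hempty, measure_empty] at hinter
  rw [← hμ _ (measurableSet_sublevel b)]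
  calc b ^ θ.toReal ≤ ⨅ d : D', (μ (Ioi (d : ℝ) ∩ D) + μ (sublevel θ ω b)) := by
        refine le_iInf fun d => ?_
        calc b ^ θ.toReal ≤ tail θ ω d ^ θ.toReal := by gcongr; exact (hD' d.2).2.le
          _ = μ (Ioi (d : ℝ)) := (hT d).symm
          _ ≤ μ ((Ioi (d : ℝ) ∩ D) ∪ sublevel θ ω b) := by
              refine measure_mono fun x hx => ?_
              have hx0 : 0 < x := (hD' d.2).1.trans hx
              rcases lt_or_ge b (tail θ ω x) with h | h
              exacts [Or.inl ⟨hx, hx0, h⟩, Or.inr ⟨hx0, h⟩]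
          _ ≤ _ := measure_union_le _ _
    _ = μ (sublevel θ ω b) := by rw [← ENNReal.iInf_add, ← hinter, zero_add]

/-- The constant of `dyadic_rpow_le_setLIntegral_layer`. -/
def layerConst (θ : ℝ≥0∞) : ℝ≥0∞ := (1 - 2 ^ (-θ.toReal))⁻¹

theorem layerConst_ne_top (hθ : 0 < θ) (hθ' : θ ≠ ∞) : layerConst θ ≠ ∞ := by
  have hr := ENNReal.toReal_pos hθ.ne' hθ'
  refine ENNReal.inv_ne_top.2 (tsub_pos_of_lt ?_).ne'
  exact ENNReal.rpow_lt_one_of_one_lt_of_neg (by norm_num) (by linarith)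

/-- The k-th sublevel set carries mass at least 2^{-kθ} and the next one at most 2^{-θ} times that,
so a fixed proportion stays in the layer. -/
theorem dyadic_rpow_le_setLIntegral_layer (hθ : 0 < θ) (hθ' : θ ≠ ∞) (hω : IsOmega θ ω) {k : ℤ}
    (hb : dyadic k < tail θ ω 0) :
    dyadic k ^ θ.toReal ≤ layerConst θ * ∫⁻ r in layer θ ω k, ω r ^ θ.toReal := by
  have hr := ENNReal.toReal_pos hθ.ne' hθ'
  have hρ : (2 : ℝ≥0∞) ^ (-θ.toReal) < 1 :=
    ENNReal.rpow_lt_one_of_one_lt_of_neg (by norm_num) (by linarith)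
  have h1 : sublevel θ ω (dyadic k) ⊆ layer θ ω k ∪ sublevel θ ω (dyadic (k + 1)) := by
    intro t ht
    rcases lt_or_ge (dyadic (k + 1)) (tail θ ω t) with h | h
    exacts [Or.inl ⟨ht.1, h, ht.2⟩, Or.inr ⟨ht.1, h⟩]
  have h2 : ∫⁻ r in sublevel θ ω (dyadic (k + 1)), ω r ^ θ.toReal ≤
      2 ^ (-θ.toReal) * dyadic k ^ θ.toReal := by
    rw [← uNorm_rpow hθ.ne' hθ', dyadic_eq_two_mul k, ENNReal.mul_rpow_of_nonneg _ _ hr.le,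
      ← mul_assoc, ← two_rpow_add, neg_add_cancel, ENNReal.rpow_zero, one_mul]
    gcongr
    exact uNorm_sublevel_le hθ _
  have h3 : dyadic k ^ θ.toReal ≤ (∫⁻ r in layer θ ω k, ω r ^ θ.toReal) +
      2 ^ (-θ.toReal) * dyadic k ^ θ.toReal := by
    refine (le_setLIntegral_sublevel hθ hθ' hω hb).trans ?_
    refine (lintegral_mono_set h1).trans ((lintegral_union_le _ _ _).trans ?_)
    gcongr
  have hfin : dyadic k ^ θ.toReal ≠ ∞ := ENNReal.rpow_ne_top_of_nonneg hr.le (dyadic_ne_top k)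
  rw [layerConst, ← ENNReal.div_eq_inv_mul, ENNReal.le_div_iff_mul_le
    (Or.inl (tsub_pos_of_lt hρ).ne') (Or.inl (ne_top_of_le_ne_top ENNReal.one_ne_top tsub_le_self)),
    ENNReal.mul_sub (fun _ _ => hfin), mul_one, tsub_le_iff_right, mul_comm _ (_ ^ (-_))]
  exact h3

/-- Discretization from below of `‖ω F‖_{θ,(0,∞)}`, for `θ < ∞`. -/
theorem tsum_le_uNorm_mul (hθ : 0 < θ) (hθ' : θ ≠ ∞) (hω : IsOmega θ ω) {F : ℝ → ℝ≥0∞}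
    {G : ℤ → ℝ≥0∞} (h : ∀ k r, 0 < r → tail θ ω r ≤ dyadic k → G k ≤ F r)
    (h0 : ∀ k, tail θ ω 0 ≤ dyadic k → G k = 0) :
    (∑' k, (dyadic k * G k) ^ θ.toReal) ^ (1 / θ.toReal) ≤
      layerConst θ ^ (1 / θ.toReal) * uNorm θ (Ioi 0) fun r => ω r * F r := by
  have hr := ENNReal.toReal_pos hθ.ne' hθ'
  rw [uNorm_of_ne_top hθ', ← ENNReal.mul_rpow_of_nonneg _ _ (by positivity)]
  refine ENNReal.rpow_le_rpow ?_ (by positivity)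
  rw [← iUnion_layer hω, lintegral_iUnion measurableSet_layer pairwise_disjoint_layer,
    ← ENNReal.tsum_mul_left]
  refine ENNReal.tsum_le_tsum fun k => ?_
  rw [ENNReal.mul_rpow_of_nonneg _ _ hr.le]
  -- The mass bound for the layer requires 2^{-k} < T(0); the remaining terms vanish by `h0`.
  rcases le_or_gt (tail θ ω 0) (dyadic k) with hk | hk
  · simp [h0 k hk, hr]
  calc dyadic k ^ θ.toReal * G k ^ θ.toReal
      ≤ layerConst θ * (∫⁻ r in layer θ ω k, ω r ^ θ.toReal) * G k ^ θ.toReal := by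
        gcongr; exact dyadic_rpow_le_setLIntegral_layer hθ hθ' hω hk
    _ ≤ layerConst θ * ∫⁻ r in layer θ ω k, ω r ^ θ.toReal * G k ^ θ.toReal := by
        rw [mul_assoc]; gcongr; exact lintegral_mul_const_le _ _
    _ ≤ _ := by
        refine mul_le_mul_right (setLIntegral_mono' (measurableSet_layer k) fun r hr' => ?_) _
        rw [ENNReal.mul_rpow_of_nonneg _ _ hr.le]
        gcongr
        exact h k r hr'.1 hr'.2.2

/-- Discretization from above of `‖ω F‖_{θ,(0,∞)}`, for `θ < ∞`. -/
theorem uNorm_mul_le_tsum (hθ : 0 < θ) (hθ' : θ ≠ ∞) (hω : IsOmega θ ω) {F : ℝ → ℝ≥0∞}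
    {X : ℤ → ℝ≥0∞} (h : ∀ k, ∀ r ∈ layer θ ω k, dyadic k * F r ≤ X k) :
    uNorm θ (Ioi 0) (fun r => ω r * F r) ≤ (∑' k, X k ^ θ.toReal) ^ (1 / θ.toReal) := by
  have hr := ENNReal.toReal_pos hθ.ne' hθ'
  rw [uNorm_of_ne_top hθ']
  refine ENNReal.rpow_le_rpow ?_ (by positivity)
  rw [← iUnion_layer hω, lintegral_iUnion measurableSet_layer pairwise_disjoint_layer]
  refine ENNReal.tsum_le_tsum fun k => ?_
  have hd : (dyadic k)⁻¹ ^ θ.toReal ≠ ∞ :=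
    ENNReal.rpow_ne_top_of_nonneg hr.le (ENNReal.inv_ne_top.2 (dyadic_pos k).ne')
  calc ∫⁻ r in layer θ ω k, (ω r * F r) ^ θ.toReal
      ≤ ∫⁻ r in layer θ ω k, X k ^ θ.toReal * ((dyadic k)⁻¹ ^ θ.toReal * ω r ^ θ.toReal) := by
        refine setLIntegral_mono' (measurableSet_layer k) fun r hr' => ?_
        rw [← ENNReal.mul_rpow_of_nonneg _ _ hr.le, ← ENNReal.mul_rpow_of_nonneg _ _ hr.le]
        refine ENNReal.rpow_le_rpow ?_ hr.le
        calc ω r * F r = ω r * (dyadic k)⁻¹ * (dyadic k * F r) := by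
              rw [mul_assoc, ← mul_assoc (dyadic k)⁻¹,
                ENNReal.inv_mul_cancel (dyadic_pos k).ne' (dyadic_ne_top k), one_mul]
          _ ≤ ω r * (dyadic k)⁻¹ * X k := by gcongr; exact h k r hr'
          _ = _ := by ring
    _ ≤ ∫⁻ r in sublevel θ ω (dyadic k),
          X k ^ θ.toReal * ((dyadic k)⁻¹ ^ θ.toReal * ω r ^ θ.toReal) :=
        lintegral_mono_set (layer_subset_sublevel k)
    _ ≤ X k ^ θ.toReal := by
      by_cases hX : X k = ∞
      · rw [hX, ENNReal.top_rpow_of_pos hr]; exact le_top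
      rw [lintegral_const_mul' _ _ (ENNReal.rpow_ne_top_of_nonneg hr.le hX),
        lintegral_const_mul' _ _ hd, ← uNorm_rpow hθ.ne' hθ',
        ← ENNReal.mul_rpow_of_nonneg _ _ hr.le]
      refine mul_le_of_le_one_right' (ENNReal.rpow_le_one ?_ hr.le)
      rw [← ENNReal.inv_mul_cancel (dyadic_pos k).ne' (dyadic_ne_top k)]
      gcongr
      exact uNorm_sublevel_le hθ _

/-- Counterpart of `uNorm_mul_le_tsum` at θ = ∞: almost everywhere on the k-th layer ω ≤ 2^{-k}. -/
theorem uNorm_top_mul_le_iSup (hω : IsOmega ∞ ω) {F : ℝ → ℝ≥0∞}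
    {X : ℤ → ℝ≥0∞} (h : ∀ k, ∀ r ∈ layer ∞ ω k, dyadic k * F r ≤ X k) :
    uNorm ∞ (Ioi 0) (fun r => ω r * F r) ≤ ⨆ k, X k := by
  rw [uNorm_top]
  refine essSup_le_of_ae_le _ ?_
  rw [← iUnion_layer hω, Filter.EventuallyLE, ae_restrict_iUnion_iff]
  intro k
  have h1 : ∀ᵐ r ∂volume.restrict (layer ∞ ω k), ω r ≤ dyadic k := by
    have h2 := ENNReal.ae_le_essSup (μ := volume.restrict (sublevel ∞ ω (dyadic k))) ω
    rw [← uNorm_top] at h2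
    exact (ae_restrict_of_ae_restrict_of_subset (layer_subset_sublevel k) h2).mono
      fun r hr => hr.trans (uNorm_sublevel_le ENNReal.zero_lt_top _)
  filter_upwards [h1, ae_restrict_mem (measurableSet_layer k)] with r h1 hr
  refine le_trans ?_ (le_iSup X k)
  refine le_trans ?_ (h k r hr)
  gcongr

/-- Since F(r) ≤ F(t) for t > r, the factor moves inside the essential supremum. At θ = ∞ this
replaces the mass bounds on layers. -/
theorem tail_top_mul_le {F : ℝ → ℝ≥0∞} {r : ℝ} (hr : 0 ≤ r) (hF : MonotoneOn F (Ici r)) :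
    tail ∞ ω r * F r ≤ uNorm ∞ (Ioi 0) fun t => ω t * F t := by
  rw [tail, uNorm_top, uNorm_top, mul_comm, ← ENNReal.essSup_const_mul]
  refine le_trans (essSup_mono_ae ?_) (essSup_mono_measure
    (Measure.absolutelyContinuous_of_le (Measure.restrict_mono (Ioi_subset_Ioi hr) le_rfl)))
  filter_upwards [ae_restrict_mem measurableSet_Ioi] with t ht
  rw [mul_comm]
  gcongr
  exact hF (mem_Ici.2 le_rfl) (mem_Ici.2 (le_of_lt ht)) (le_of_lt ht)

end Tail

/-! ### Layer-cake comparison of dyadic sums with integrals. -/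

section LayerCake

theorem lintegral_indicator_ofReal_lt (a : ℝ≥0∞) :
    ∫⁻ y in Ioi (0 : ℝ), {y | ENNReal.ofReal y < a}.indicator 1 y = a := by
  have hm : MeasurableSet {y : ℝ | ENNReal.ofReal y < a} :=
    measurableSet_lt ENNReal.measurable_ofReal measurable_const
  rw [lintegral_indicator_one hm, Measure.restrict_apply hm]
  by_cases ha : a = ∞
  · have : {y : ℝ | ENNReal.ofReal y < a} ∩ Ioi 0 = Ioi 0 := by
      rw [inter_eq_right]; intro y _; simp [ha]
    rw [this, Real.volume_Ioi, ha]
  · have : {y : ℝ | ENNReal.ofReal y < a} ∩ Ioi 0 = Ioo 0 a.toReal := by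
      ext y
      simp only [mem_inter_iff, mem_ofPred_eq, mem_Ioi, mem_Ioo]
      refine ⟨fun ⟨h1, h2⟩ => ⟨h2, (ENNReal.ofReal_lt_iff_lt_toReal h2.le ha).1 h1⟩,
        fun ⟨h1, h2⟩ => ⟨(ENNReal.ofReal_lt_iff_lt_toReal h1.le ha).2 h2, h1⟩⟩
    rw [this, Real.volume_Ioo, sub_zero, ENNReal.ofReal_toReal ha]

theorem lintegral_measure_ofReal_lt_le (ν : Measure ℝ) {g : ℝ → ℝ≥0∞} (hg : Measurable g) :
    ∫⁻ y in Ioi (0 : ℝ), ν {t | ENNReal.ofReal y < g t} ≤ ∫⁻ t, g t ∂ν := by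
  by_cases hfin : ∫⁻ t, g t ∂ν = ∞
  · rw [hfin]; exact le_top
  have hae := ae_lt_top hg hfin
  have h1 : ∫⁻ t, g t ∂ν = ∫⁻ t, ENNReal.ofReal (g t).toReal ∂ν :=
    lintegral_congr_ae (hae.mono fun t ht => (ENNReal.ofReal_toReal ht.ne).symm)
  rw [h1, lintegral_eq_lintegral_meas_lt ν (ae_of_all _ fun _ => ENNReal.toReal_nonneg)
    hg.ennreal_toReal.aemeasurable]
  refine setLIntegral_mono' measurableSet_Ioi fun y hy => measure_mono_ae ?_
  filter_upwards [hae] with t ht hyt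
  exact (ENNReal.ofReal_lt_iff_lt_toReal (le_of_lt hy) ht.ne).1 hyt

/-- Discretization of a Stieltjes integral from below. -/
theorem tsum_two_rpow_mul_le {s : ℝ} (hs : 0 < s) (ν : Measure ℝ) {g : ℝ → ℝ≥0∞}
    (hg : Measurable g) {a : ℤ → ℝ≥0∞} {c v : ℝ≥0∞} (ha : ∀ k, a k ≤ v)
    (h : ∀ k, a k ≠ 0 → (2 : ℝ≥0∞) ^ (s * k) ≤ ν {t | a k ≤ g t} + c) :
    ∑' k : ℤ, (2 : ℝ≥0∞) ^ (s * k) * a k ≤ geomSum s * ((∫⁻ t, g t ∂ν) + c * v) := by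
  have hm : ∀ b : ℝ≥0∞, MeasurableSet {y : ℝ | ENNReal.ofReal y < b} := fun b =>
    measurableSet_lt ENNReal.measurable_ofReal measurable_const
  have hi : ∀ b : ℝ≥0∞, Measurable ({y : ℝ | ENNReal.ofReal y < b}.indicator (1 : ℝ → ℝ≥0∞)) :=
    fun b => measurable_one.indicator (hm b)
  -- Write a_k as the integral of the indicator of y < a_k and exchange sum and integral. At fixed y
  -- the sum of 2^{sk} over a_k > y is controlled by its largest term, hence through `h` by ν{g > y}
  -- + c.
  calc ∑' k : ℤ, (2 : ℝ≥0∞) ^ (s * k) * a k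
      = ∑' k : ℤ, ∫⁻ y in Ioi (0 : ℝ),
          2 ^ (s * k) * {y | ENNReal.ofReal y < a k}.indicator 1 y := by
        congr 1; ext k
        rw [lintegral_const_mul _ (hi _), lintegral_indicator_ofReal_lt]
    _ = ∫⁻ y in Ioi (0 : ℝ), ∑' k : ℤ,
          2 ^ (s * k) * {y | ENNReal.ofReal y < a k}.indicator 1 y :=
        (lintegral_tsum fun k => ((hi _).const_mul _).aemeasurable).symm
    _ ≤ ∫⁻ y in Ioi (0 : ℝ), geomSum s * (ν {t | ENNReal.ofReal y < g t} +
          c * {y | ENNReal.ofReal y < v}.indicator 1 y) := by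
        refine lintegral_mono fun y => ?_
        have e : ∀ k : ℤ, 2 ^ (s * k) * {y | ENNReal.ofReal y < a k}.indicator 1 y =
            {k : ℤ | ENNReal.ofReal y < a k}.indicator
              (fun k : ℤ => (2 : ℝ≥0∞) ^ (s * k)) k := fun k => by
          by_cases hk : ENNReal.ofReal y < a k <;> simp [hk]
        simp only [e]
        refine tsum_indicator_two_rpow_le hs _ fun k hk => ?_
        have hk' : ENNReal.ofReal y < a k := hk
        refine (h k (zero_le.trans_lt hk').ne').trans ?_
        have hv : y ∈ {y | ENNReal.ofReal y < v} := hk'.trans_le (ha k)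
        rw [indicator_of_mem hv, Pi.one_apply, mul_one]
        gcongr
    _ = geomSum s * ((∫⁻ y in Ioi (0 : ℝ), ν {t | ENNReal.ofReal y < g t}) + c * v) := by
        rw [lintegral_const_mul' _ _ (geomSum_ne_top hs),
          lintegral_add_right _ ((hi v).const_mul c), lintegral_const_mul _ (hi v),
          lintegral_indicator_ofReal_lt]
    _ ≤ _ := by grw [lintegral_measure_ofReal_lt_le ν hg]

end LayerCake

/-! ### Estimates for the Stieltjes measure of T(t-)^{-s}. -/

section Stieltjes

variable {θ : ℝ≥0∞} {ω : ℝ → ℝ≥0∞} {s : ℝ}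

theorem lsMeasure_tailPow (hω : IsOmega θ ω) (hs : 0 < s) :
    lsMeasure (tailPow θ ω s) =
      (zeroExt_tailPow_monotone hω hs.le).stieltjesFunction.measure.restrict (Ioi 0) :=
  dif_pos (zeroExt_tailPow_monotone hω hs.le)

theorem lsMeasure_Ioc (hω : IsOmega θ ω) (hs : 0 < s) (t : ℝ) :
    lsMeasure (tailPow θ ω s) (Ioc 0 t) =
      ENNReal.ofReal (Function.rightLim (zeroExt (tailPow θ ω s)) t -
        Function.rightLim (zeroExt (tailPow θ ω s)) 0) := by
  rw [lsMeasure_tailPow hω hs, Measure.restrict_apply measurableSet_Ioc,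
    inter_eq_left.2 fun x hx => hx.1, StieltjesFunction.measure_Ioc,
    Monotone.stieltjesFunction_eq, Monotone.stieltjesFunction_eq]

theorem ofReal_zeroExt_tailPow (hω : IsOmega θ ω) {t : ℝ} (ht : 0 < t) :
    ENNReal.ofReal (zeroExt (tailPow θ ω s) t) = (Function.leftLim (tail θ ω) t)⁻¹ ^ s := by
  rw [zeroExt, if_pos ht, ENNReal.ofReal_toReal (tailPow_lt_top hω s ht).ne, tailPow,
    ENNReal.rpow_neg, ENNReal.inv_rpow]

/-- Right continuity gives t' > t with T(t') > a, and the right limit at t is at most T(t'-)^{-s}.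
-/
theorem ofReal_rightLim_le (hθ : 0 < θ) (hω : IsOmega θ ω) (hs : 0 < s) {t : ℝ} (ht : 0 ≤ t)
    {a : ℝ≥0∞} (ha : a < tail θ ω t) :
    ENNReal.ofReal (Function.rightLim (zeroExt (tailPow θ ω s)) t) ≤ a⁻¹ ^ s := by
  obtain ⟨t', ht', ha'⟩ := exists_gt_lt_tail hθ ha
  refine (ENNReal.ofReal_le_ofReal
    ((zeroExt_tailPow_monotone hω hs.le).rightLim_le ht')).trans ?_
  rw [ofReal_zeroExt_tailPow hω (ht.trans_lt ht')]
  gcongr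
  exact ha'.le.trans ((tail_antitone θ ω).le_leftLim le_rfl)

theorem lsMeasure_lt_tail_le (hθ : 0 < θ) (hω : IsOmega θ ω) (hs : 0 < s) (a : ℝ≥0∞) :
    lsMeasure (tailPow θ ω s) {t | 0 < t ∧ a < tail θ ω t} ≤ a⁻¹ ^ s := by
  have hsub : {t | 0 < t ∧ a < tail θ ω t} ⊆
      ⋃ t ∈ {t | 0 < t ∧ a < tail θ ω t}, Ioc (0 : ℝ) t :=
    fun t ht => mem_biUnion ht ⟨ht.1, le_rfl⟩
  refine (measure_mono hsub).trans (measure_biUnion_le _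
    (Or.inl fun a b hab => Ioc_subset_Ioc_right hab) fun t ht => ?_)
  rw [lsMeasure_Ioc hω hs]
  refine le_trans (ENNReal.ofReal_le_ofReal ?_) (ofReal_rightLim_le hθ hω hs ht.1.le ht.2)
  have h0 : zeroExt (tailPow θ ω s) 0 ≤ Function.rightLim (zeroExt (tailPow θ ω s)) 0 :=
    (zeroExt_tailPow_monotone hω hs.le).le_rightLim le_rfl
  have h1 : zeroExt (tailPow θ ω s) 0 = 0 := if_neg (lt_irrefl 0)
  linarith

/-- This bounds the atom at 0 that `lsMeasure` discards, and explains the second summand in (b). -/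
theorem ofReal_rightLim_zero_le (hθ : 0 < θ) (hω : IsOmega θ ω) (hs : 0 < s) :
    ENNReal.ofReal (Function.rightLim (zeroExt (tailPow θ ω s)) 0) ≤ (tail θ ω 0)⁻¹ ^ s := by
  rw [← ENNReal.rpow_inv_le_iff hs, ENNReal.le_inv_iff_le_inv]
  refine le_of_forall_lt fun a ha => ?_
  obtain ⟨b, hab, hb⟩ := exists_between ha
  refine hab.trans_le ?_
  rw [ENNReal.le_inv_iff_le_inv, ENNReal.rpow_inv_le_iff hs]
  exact ofReal_rightLim_le hθ hω hs le_rfl hb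

/-- For t > R one has T(t-) ≤ T(R) ≤ b, so the right limit at R is at least b^{-s}; subtracting the
right limit at 0 leaves the measure of (0,R]. -/
theorem le_lsMeasure_Ioc_add (hθ : 0 < θ) (hω : IsOmega θ ω) (hs : 0 < s) {R : ℝ} (hR : 0 ≤ R)
    {b : ℝ≥0∞} (hb : b ≠ 0) (hT : tail θ ω R ≤ b) :
    b⁻¹ ^ s ≤ lsMeasure (tailPow θ ω s) (Ioc 0 R) + (tail θ ω 0)⁻¹ ^ s := by
  have hfin : b⁻¹ ^ s ≠ ∞ := ENNReal.rpow_ne_top_of_nonneg hs.le (ENNReal.inv_ne_top.2 hb)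
  have h1 : b⁻¹ ^ s ≤ ENNReal.ofReal (Function.rightLim (zeroExt (tailPow θ ω s)) R) := by
    rw [← ENNReal.ofReal_toReal hfin]
    refine ENNReal.ofReal_le_ofReal ?_
    refine ge_of_tendsto ((zeroExt_tailPow_monotone hω hs.le).tendsto_rightLim R) ?_
    filter_upwards [self_mem_nhdsWithin] with t ht
    have ht' : 0 < t := hR.trans_lt ht
    rw [zeroExt, if_pos ht']
    refine ENNReal.toReal_mono (tailPow_lt_top hω s ht').ne ?_
    rw [tailPow, ENNReal.rpow_neg, ← ENNReal.inv_rpow]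
    gcongr
    exact ((tail_antitone θ ω).leftLim_le ht).trans hT
  rw [lsMeasure_Ioc hω hs]
  calc b⁻¹ ^ s ≤ ENNReal.ofReal (Function.rightLim (zeroExt (tailPow θ ω s)) R) := h1
    _ ≤ ENNReal.ofReal ((Function.rightLim (zeroExt (tailPow θ ω s)) R -
        Function.rightLim (zeroExt (tailPow θ ω s)) 0) +
          Function.rightLim (zeroExt (tailPow θ ω s)) 0) := by rw [sub_add_cancel]
    _ ≤ _ := ENNReal.ofReal_add_le
    _ ≤ _ := by gcongr; exact ofReal_rightLim_zero_le hθ hω hs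

end Stieltjes

variable {n : ℕ} {p₁ p₂ θ : ℝ≥0∞} {v₁ v₂ : Rn n → ℝ≥0∞} {ω : ℝ → ℝ≥0∞}

/-! ### The best embedding constant. -/

section Embedding

theorem embedNorm_le {F : Type*} {X Y : Set F} {NX NY : F → ℝ≥0∞} {D : ℝ≥0∞}
    (h : D ≠ ∞ → ∀ c : ℝ≥0, 0 < c → D ≤ c → IsEmbedConst X Y NX NY c) :
    embedNorm X Y NX NY ≤ D := by
  by_cases hD : D = ∞
  · rw [hD]; exact le_top
  -- The ε keeps the constant positive when D = 0.
  refine ENNReal.le_of_forall_pos_le_add fun ε hε _ => ?_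
  have hc : ((D.toNNReal + ε : ℝ≥0) : ℝ≥0∞) = D + ε := by
    rw [ENNReal.coe_add, ENNReal.coe_toNNReal hD]
  rw [← hc]
  exact iInf₂_le _ ⟨add_pos_of_nonneg_of_pos zero_le hε,
    h hD _ (add_pos_of_nonneg_of_pos zero_le hε) (by rw [hc]; exact le_self_add)⟩

theorem le_mul_embedNorm {F : Type*} {X Y : Set F} {NX NY : F → ℝ≥0∞} {B : ℝ≥0∞} {C : ℝ≥0}
    (hC : 0 < C) (h : ∀ c : ℝ≥0, IsEmbedConst X Y NX NY c → B ≤ C * c) :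
    B ≤ C * embedNorm X Y NX NY := by
  have hC' : (C : ℝ≥0∞) ≠ 0 := by exact_mod_cast hC.ne'
  rw [mul_comm, ← ENNReal.div_le_iff hC' ENNReal.coe_ne_top]
  refine le_iInf₂ fun c hc => ?_
  rw [ENNReal.div_le_iff hC' ENNReal.coe_ne_top, mul_comm]
  exact h c hc.2

theorem idNorm_le {D : ℝ≥0∞}
    (h : ∀ f, AEMeasurable f → lebNorm p₁ v₁ f ≤ D * morreyNorm p₂ θ ω v₂ f) :
    idNorm p₁ p₂ θ v₁ v₂ ω ≤ D := by
  refine embedNorm_le fun hD c _ hc => ⟨fun f hf => ⟨hf.1.1, ?_⟩, fun f hf => ?_⟩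
  · exact (h f hf.1.1).trans_lt (ENNReal.mul_lt_top hD.lt_top hf.2)
  · exact (h f hf.1.1).trans (by gcongr)

end Embedding

/-! ### Radial shells, the upper estimate, and comparison with the Stieltjes integral. -/

section Shells

/-- The radial set of all `x` with `‖x‖ ∈ S`. -/
def radial (n : ℕ) (S : Set ℝ) : Set (Rn n) := {x | ‖x‖ ∈ S}

theorem measurableSet_radial {S : Set ℝ} (hS : MeasurableSet S) : MeasurableSet (radial n S) :=
  measurable_norm hS

/-- Only the origin is missed, and it is null because n ≥ 1. -/
theorem ae_le_iUnion_radial_layer (hn : 0 < n) (hω : IsOmega θ ω) (B : Set (Rn n)) :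
    B ≤ᵐ[volume] ⋃ k, B ∩ radial n (layer θ ω k) := by
  have : Nonempty (Fin n) := ⟨⟨0, hn⟩⟩
  have h0 : ∀ᵐ x : Rn n, x ≠ 0 := by
    rw [ae_iff]; simp
  filter_upwards [h0] with x hx hxB
  obtain ⟨k, hk⟩ := exists_mem_layer hω (norm_pos_iff.2 hx)
  exact mem_iUnion.2 ⟨k, hxB, hk⟩

theorem pairwise_disjoint_radial_layer :
    Pairwise (Function.onFun Disjoint fun k => radial n (layer θ ω k)) :=
  fun _ _ hjk => disjoint_left.2 fun _ hj hk => hjk (layer_index_unique hj hk)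

theorem wNorm_empty {α : Type*} [MeasureSpace α] {p : ℝ≥0∞} (hp : 0 < p) {w f : α → ℝ≥0∞} :
    wNorm p ∅ w f = 0 := by
  by_cases h : p = ∞
  · subst h; simp [wNorm_top]
  · have := ENNReal.toReal_pos hp.ne' h
    simp [wNorm_of_ne_top h, this]

/-- `‖v₁^{1/p₁} v₂^{-1/p₂}‖` outside the ball where `‖ω‖_{θ,(|x|,∞)} > 2^{-k}`. -/
def outerRatio (p₁ p₂ θ : ℝ≥0∞) (v₁ v₂ : Rn n → ℝ≥0∞) (ω : ℝ → ℝ≥0∞) (k : ℤ) : ℝ≥0∞ :=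
  ratioNorm p₁ p₂ v₁ v₂ (radial n (sublevel θ ω (dyadic k)))

/-- `‖v₁^{1/p₁} v₂^{-1/p₂}‖` on the shell where `2^{-k-1} < ‖ω‖_{θ,(|x|,∞)} ≤ 2^{-k}`. -/
def shellRatio (p₁ p₂ θ : ℝ≥0∞) (v₁ v₂ : Rn n → ℝ≥0∞) (ω : ℝ → ℝ≥0∞) (k : ℤ) : ℝ≥0∞ :=
  ratioNorm p₁ p₂ v₁ v₂ (radial n (layer θ ω k))

/-- `‖f‖_{p,v}` on the ball where `‖ω‖_{θ,(|x|,∞)} > 2^{-k}`. -/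
def innerNorm (p θ : ℝ≥0∞) (v : Rn n → ℝ≥0∞) (ω : ℝ → ℝ≥0∞) (f : Rn n → ℝ) (k : ℤ) : ℝ≥0∞ :=
  wNorm p (radial n {t | dyadic k < tail θ ω t}) v (fun x => ‖f x‖ₑ)

theorem ratioNorm_mono {A B : Set (Rn n)} (h : A ⊆ B) :
    ratioNorm p₁ p₂ v₁ v₂ A ≤ ratioNorm p₁ p₂ v₁ v₂ B := wNorm_mono_set h

/-- Hölder on each shell, which is then enlarged outwards for W and inwards for f. The index k + 1
appears because T > 2^{-(k+1)} on the k-th layer. -/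
theorem lebNorm_le_tsum (hn : 0 < n) (hp₁ : 0 < p₁) (hp : p₁ ≤ p₂) (hp₂ : p₂ < ∞)
    (hv₁ : IsWeight v₁) (hv₂ : IsWeight v₂) (hω : IsOmega θ ω) {f : Rn n → ℝ}
    (hf : AEMeasurable f) :
    lebNorm p₁ v₁ f ≤ (∑' k, (((dyadic k)⁻¹ * outerRatio p₁ p₂ θ v₁ v₂ ω k) *
      (dyadic k * innerNorm p₂ θ v₂ ω f (k + 1))) ^ p₁.toReal) ^ (1 / p₁.toReal) := by
  have h1t : p₁ ≠ ∞ := (hp.trans_lt hp₂).ne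
  have hp' : 0 < p₁.toReal := ENNReal.toReal_pos hp₁.ne' h1t
  refine (wNorm_mono_ae_set (ae_le_iUnion_radial_layer hn hω univ)).trans ?_
  rw [wNorm_of_ne_top h1t]
  refine ENNReal.rpow_le_rpow ((lintegral_iUnion_le _ _).trans ?_) (by positivity)
  refine ENNReal.tsum_le_tsum fun k => ?_
  rw [← wNorm_rpow hp₁.ne' h1t, univ_inter]
  refine ENNReal.rpow_le_rpow ?_ hp'.le
  refine (wNorm_le_ratioNorm_mul hp₁ hp hp₂ hv₁ hv₂ hf.enorm).trans ?_
  rw [mul_mul_mul_comm, ENNReal.inv_mul_cancel (dyadic_pos k).ne' (dyadic_ne_top k), one_mul]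
  exact mul_le_mul' (ratioNorm_mono fun x hx => layer_subset_sublevel k hx)
    (wNorm_mono_set fun x hx => hx.2.1)

theorem radial_lt_tail_eq_empty {b : ℝ≥0∞} (h : tail θ ω 0 ≤ b) :
    radial n {t | b < tail θ ω t} = ∅ :=
  eq_empty_iff_forall_notMem.2 fun x hx =>
    absurd hx (not_lt.2 ((tail_antitone θ ω (norm_nonneg x)).trans h))

/-- If T(r) ≤ 2^{-k}, the region T(|x|) > 2^{-k} lies in B(0,r), so `tsum_le_uNorm_mul` applies. The
factor 2 is the cost of the index shift. -/
theorem tsum_innerNorm_le (hp₂ : 0 < p₂) (hθ : 0 < θ) (hθ' : θ ≠ ∞) (hω : IsOmega θ ω)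
    (f : Rn n → ℝ) :
    (∑' k, (dyadic k * innerNorm p₂ θ v₂ ω f (k + 1)) ^ θ.toReal) ^ (1 / θ.toReal) ≤
      2 * layerConst θ ^ (1 / θ.toReal) * morreyNorm p₂ θ ω v₂ f := by
  have hr := ENNReal.toReal_pos hθ.ne' hθ'
  have h1 := tsum_le_uNorm_mul hθ hθ' hω (G := innerNorm p₂ θ v₂ ω f)
    (F := fun r => wNorm p₂ (Metric.ball 0 r) v₂ (fun x => ‖f x‖ₑ)) ?_ ?_
  · calc (∑' k, (dyadic k * innerNorm p₂ θ v₂ ω f (k + 1)) ^ θ.toReal) ^ (1 / θ.toReal)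
        = (∑' k : ℤ, 2 ^ θ.toReal * (dyadic (k + 1) *
            innerNorm p₂ θ v₂ ω f (k + 1)) ^ θ.toReal) ^ (1 / θ.toReal) := by
          congr 2; ext k
          rw [dyadic_eq_two_mul k, mul_assoc, ENNReal.mul_rpow_of_nonneg _ _ hr.le]
      _ = 2 * (∑' k : ℤ, (dyadic k * innerNorm p₂ θ v₂ ω f k) ^ θ.toReal) ^ (1 / θ.toReal) := by
          rw [ENNReal.tsum_mul_left, ENNReal.mul_rpow_of_nonneg _ _ (by positivity), one_div,
            ENNReal.rpow_rpow_inv hr.ne', ← (Equiv.addRight (1 : ℤ)).tsum_eq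
              fun k => (dyadic k * innerNorm p₂ θ v₂ ω f k) ^ θ.toReal]
          rfl
      _ ≤ _ := by rw [mul_assoc]; gcongr; exact h1
  · intro k r hr0 hrk
    refine wNorm_mono_set fun x hx => ?_
    rw [mem_ball_zero_iff]
    by_contra! hc
    exact absurd (((tail_antitone θ ω) hc).trans hrk) (not_le.2 hx)
  · intro k hk
    rw [innerNorm, radial_lt_tail_eq_empty hk, wNorm_empty hp₂]

/-- By right continuity the inner region is covered by the balls B(0,t) with T(t) > 2^{-(k+1)}, to
each of which `tail_top_mul_le` applies. -/
theorem innerNorm_top_le (hp₂ : 0 < p₂) (f : Rn n → ℝ) (k : ℤ) :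
    dyadic k * innerNorm p₂ ∞ v₂ ω f (k + 1) ≤ 2 * morreyNorm p₂ ∞ ω v₂ f := by
  rw [dyadic_eq_two_mul k, mul_assoc]
  gcongr
  rw [mul_comm, ← ENNReal.le_div_iff_mul_le (Or.inl (dyadic_pos _).ne') (Or.inl (dyadic_ne_top _))]
  have hsub : radial n {t | dyadic (k + 1) < tail ∞ ω t} ⊆
      ⋃ t ∈ {t | 0 < t ∧ dyadic (k + 1) < tail ∞ ω t}, Metric.ball (0 : Rn n) t := by
    intro x hx
    obtain ⟨t, ht, ht'⟩ := exists_gt_lt_tail ENNReal.zero_lt_top hx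
    exact mem_biUnion (x := t) ⟨(norm_nonneg x).trans_lt ht, ht'⟩ (mem_ball_zero_iff.2 ht)
  refine (wNorm_mono_set hsub).trans (wNorm_biUnion_le
    (Or.inl fun a b hab => Metric.ball_subset_ball hab) hp₂ fun t ht => ?_)
  rw [ENNReal.le_div_iff_mul_le (Or.inl (dyadic_pos _).ne') (Or.inl (dyadic_ne_top _)), mul_comm]
  calc _ ≤ tail ∞ ω t * wNorm p₂ (Metric.ball 0 t) v₂ (fun x => ‖f x‖ₑ) := by
        gcongr; exact ht.2.le
    _ ≤ _ := tail_top_mul_le ht.1.le fun a _ b _ hab =>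
        wNorm_mono_set (Metric.ball_subset_ball hab)

theorem radial_sublevel_subset (b : ℝ≥0∞) :
    radial n (sublevel θ ω b) ⊆ ⋃ t ∈ sublevel θ ω b, (Metric.ball (0 : Rn n) t)ᶜ :=
  fun x hx => mem_biUnion (x := ‖x‖) hx (by simp)

theorem antitone_compl_ball : Antitone fun t => (Metric.ball (0 : Rn n) t)ᶜ :=
  fun _ _ hab => compl_subset_compl.2 (Metric.ball_subset_ball hab)

theorem outerRatio_le_of_forall (hp₁ : 0 < p₁) {S : ℝ≥0∞} (hω : IsOmega θ ω)
    (h : ∀ t, 0 < t → (tail θ ω t)⁻¹ * ratioNorm p₁ p₂ v₁ v₂ (Metric.ball 0 t)ᶜ ≤ S) (k : ℤ) :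
    (dyadic k)⁻¹ * outerRatio p₁ p₂ θ v₁ v₂ ω k ≤ S := by
  rw [mul_comm, ← div_eq_mul_inv,
    ENNReal.div_le_iff (dyadic_pos _).ne' (dyadic_ne_top _)]
  refine (wNorm_mono_set (radial_sublevel_subset _)).trans
    (wNorm_biUnion_le (Or.inr antitone_compl_ball) (gapExp_pos hp₁) fun t ht => ?_)
  have := h t ht.1
  rw [mul_comm, ← div_eq_mul_inv,
    ENNReal.div_le_iff (hω.2 t ht.1).1.ne' (hω.2 t ht.1).2.ne] at this
  refine this.trans ?_
  gcongr
  exact ht.2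

theorem measurable_ratioNorm_compl_ball :
    Measurable fun t => ratioNorm p₁ p₂ v₁ v₂ (Metric.ball 0 t)ᶜ :=
  Antitone.measurable fun _ _ hab => ratioNorm_mono (antitone_compl_ball hab)

theorem dyadic_inv_rpow (s : ℝ) (k : ℤ) : (dyadic k)⁻¹ ^ s = 2 ^ (s * k) := by
  rw [dyadic_inv, ← ENNReal.rpow_mul, mul_comm]

/-- With R the infimum of the k-th sublevel set, the integrand is at least the s-th power of
`outerRatio` on (0,R], and T(R) ≤ 2^{-k} makes this interval heavy enough for
`tsum_two_rpow_mul_le`. -/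
theorem tsum_outerRatio_le (hp₁ : 0 < p₁) (hθ : 0 < θ) (hω : IsOmega θ ω) {s : ℝ} (hs : 0 < s) :
    ∑' k, ((dyadic k)⁻¹ * outerRatio p₁ p₂ θ v₁ v₂ ω k) ^ s ≤ geomSum s *
      ((∫⁻ t, ratioNorm p₁ p₂ v₁ v₂ (Metric.ball 0 t)ᶜ ^ s ∂(lsMeasure (tailPow θ ω s))) +
        (tail θ ω 0)⁻¹ ^ s * ratioNorm p₁ p₂ v₁ v₂ univ ^ s) := by
  simp only [ENNReal.mul_rpow_of_nonneg _ _ hs.le, dyadic_inv_rpow]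
  refine tsum_two_rpow_mul_le hs _ (measurable_ratioNorm_compl_ball.pow_const s)
    (fun k => by gcongr; exact ratioNorm_mono (subset_univ _)) fun k hk => ?_
  have hne : (sublevel θ ω (dyadic k)).Nonempty := by
    by_contra hc
    rw [not_nonempty_iff_eq_empty] at hc
    refine hk ?_
    have : radial n (sublevel θ ω (dyadic k)) = ∅ := by rw [hc]; rfl
    rw [outerRatio, this, ratioNorm, uNorm, wNorm_empty (gapExp_pos hp₁), ENNReal.zero_rpow_of_pos hs]
  set R := sInf (sublevel θ ω (dyadic k))
  have hbdd : BddBelow (sublevel θ ω (dyadic k)) := ⟨0, fun t ht => ht.1.le⟩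
  have hR : 0 ≤ R := le_csInf hne fun t ht => ht.1.le
  have hT : tail θ ω R ≤ dyadic k := tail_le_of_forall_gt hθ fun t ht => by
    obtain ⟨r, hr, hrt⟩ := exists_lt_of_csInf_lt hne ht
    exact (tail_antitone θ ω hrt.le).trans hr.2
  rw [← dyadic_inv_rpow]
  refine (le_lsMeasure_Ioc_add hθ hω hs hR (dyadic_pos k).ne' hT).trans ?_
  gcongr
  intro t ht
  refine ENNReal.rpow_le_rpow (ratioNorm_mono fun x hx => ?_) hs.le
  simp only [mem_compl_iff, mem_ball_zero_iff, not_lt]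
  exact ht.2.trans (csInf_le hbdd hx)

/-- On the k-th layer the integrand is at most the s-th power of `outerRatio`, and the layer has
measure at most 2^{s(k+1)}. -/
theorem lintegral_lsMeasure_le (hθ : 0 < θ) (hω : IsOmega θ ω) {s : ℝ} (hs : 0 < s) :
    ∫⁻ t, ratioNorm p₁ p₂ v₁ v₂ (Metric.ball 0 t)ᶜ ^ s ∂(lsMeasure (tailPow θ ω s)) ≤
      2 ^ s * ∑' k, ((dyadic k)⁻¹ * outerRatio p₁ p₂ θ v₁ v₂ ω k) ^ s := by
  have h0 : lsMeasure (tailPow θ ω s) = (lsMeasure (tailPow θ ω s)).restrict (Ioi 0) := by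
    rw [lsMeasure_tailPow hω hs, Measure.restrict_restrict measurableSet_Ioi, inter_self]
  rw [h0, ← iUnion_layer hω, lintegral_iUnion measurableSet_layer pairwise_disjoint_layer,
    ← ENNReal.tsum_mul_left]
  refine ENNReal.tsum_le_tsum fun k => ?_
  calc _ ≤ ∫⁻ t in layer θ ω k, outerRatio p₁ p₂ θ v₁ v₂ ω k ^ s ∂lsMeasure (tailPow θ ω s) := by
        refine setLIntegral_mono' (measurableSet_layer k) fun t ht => ?_
        refine ENNReal.rpow_le_rpow (ratioNorm_mono fun x hx => ?_) hs.le
        simp only [mem_compl_iff, mem_ball_zero_iff, not_lt] at hx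
        exact ⟨ht.1.trans_le hx, (tail_antitone θ ω hx).trans ht.2.2⟩
    _ = outerRatio p₁ p₂ θ v₁ v₂ ω k ^ s * lsMeasure (tailPow θ ω s) (layer θ ω k) :=
        setLIntegral_const _ _
    _ ≤ outerRatio p₁ p₂ θ v₁ v₂ ω k ^ s * (dyadic (k + 1))⁻¹ ^ s := by
        gcongr
        refine (measure_mono ?_).trans (lsMeasure_lt_tail_le hθ hω hs _)
        exact fun t ht => ⟨ht.1, ht.2.1⟩
    _ = _ := by
        rw [← ENNReal.mul_rpow_of_nonneg _ _ hs.le, ← ENNReal.mul_rpow_of_nonneg _ _ hs.le]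
        congr 1
        rw [dyadic_eq_two_mul k, ENNReal.mul_inv (by simp) (by simp), ← mul_assoc, ← mul_assoc,
          ENNReal.mul_inv_cancel (by simp) (by simp), one_mul, mul_comm]

/-- If T(0) is finite and lies in (2^{-k-1}, 2^{-k}], the k-th exterior region is almost all of ℝⁿ,
so one term of the sum suffices. -/
theorem tail_zero_inv_mul_le (hn : 0 < n) (hω : IsOmega θ ω) {s : ℝ} (hs : 0 < s) :
    (tail θ ω 0)⁻¹ * ratioNorm p₁ p₂ v₁ v₂ univ ≤
      2 * (∑' k, ((dyadic k)⁻¹ * outerRatio p₁ p₂ θ v₁ v₂ ω k) ^ s) ^ (1 / s) := by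
  by_cases hT : tail θ ω 0 = ∞
  · simp [hT]
  have hT0 : tail θ ω 0 ≠ 0 :=
    ((hω.2 1 one_pos).1.trans_le (tail_antitone θ ω zero_le_one)).ne'
  obtain ⟨k, hk1, hk2⟩ := exists_dyadic hT0 hT
  have h1 : ratioNorm p₁ p₂ v₁ v₂ univ ≤ outerRatio p₁ p₂ θ v₁ v₂ ω k := by
    refine wNorm_mono_ae_set ((ae_le_iUnion_radial_layer hn hω univ).trans
      (LE.le.eventuallyLE (iUnion_subset fun j x hx => ?_)))
    exact ⟨hx.2.1, (tail_antitone θ ω hx.2.1.le).trans hk2⟩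
  calc _ ≤ (dyadic (k + 1))⁻¹ * outerRatio p₁ p₂ θ v₁ v₂ ω k := by gcongr
    _ = 2 * ((dyadic k)⁻¹ * outerRatio p₁ p₂ θ v₁ v₂ ω k) := by
        rw [dyadic_eq_two_mul k, ENNReal.mul_inv (by simp) (by simp), ← mul_assoc, ← mul_assoc,
          ENNReal.mul_inv_cancel (by simp) (by simp), one_mul]
    _ ≤ _ := by
        gcongr
        rw [one_div, ENNReal.le_rpow_inv_iff hs]
        exact ENNReal.le_tsum k

end Shells

/-! ### Test functions assembled from shells. -/

section Test

/-- The decay 2^{-|j-k|} is split in halves: one sums the shells in `wNorm_le_of_iUnion`, the other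
stays in the maximal convolution. -/
theorem two_rpow_dist_mul {j k : ℤ} (h : j ≤ k) (y : ℝ≥0∞) :
    2 ^ (-(1 / 2 * |(j : ℝ) - k|)) * ((dyadic k)⁻¹ *
      (2 ^ (-(1 / 2 * |(j : ℝ) - k|)) * (dyadic j * y))) = y := by
  have h' : (j : ℝ) ≤ k := by exact_mod_cast h
  rw [dyadic_inv, dyadic, ← mul_assoc, ← mul_assoc, ← mul_assoc, ← two_rpow_add, ← two_rpow_add,
    ← two_rpow_add, abs_of_nonpos (by linarith)]
  have : -(1 / 2 * -((j : ℝ) - k)) + k + -(1 / 2 * -((j : ℝ) - k)) + -(j : ℝ) = 0 := by ring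
  rw [this, ENNReal.rpow_zero, one_mul]

theorem two_rpow_dist_mul' {j k : ℤ} (h : k ≤ j) (y : ℝ≥0∞) :
    2 ^ (-(1 / 2 * |(j : ℝ) - k|)) * (dyadic k *
      (2 ^ (-(1 / 2 * |(j : ℝ) - k|)) * ((dyadic j)⁻¹ * y))) = y := by
  have h' : (k : ℝ) ≤ j := by exact_mod_cast h
  rw [dyadic_inv, dyadic, ← mul_assoc, ← mul_assoc, ← mul_assoc, ← two_rpow_add, ← two_rpow_add,
    ← two_rpow_add, abs_of_nonneg (by linarith)]
  have : -(1 / 2 * ((j : ℝ) - k)) + -(k : ℝ) + -(1 / 2 * ((j : ℝ) - k)) + (j : ℝ) = 0 := by ring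
  rw [this, ENNReal.rpow_zero, one_mul]

/-- A discrete Hardy inequality: only shells with j ≥ k meet the exterior region, and 2^k =
2^{-(j-k)} 2^j. -/
theorem outerRatio_le_iSup (hn : 0 < n) (hp₁ : 0 < p₁) (hω : IsOmega θ ω) (k : ℤ) :
    (dyadic k)⁻¹ * outerRatio p₁ p₂ θ v₁ v₂ ω k ≤
      ⨆ j : ℤ, 2 ^ (-(1 / 2 * |(j : ℝ) - k|)) *
        (unionConst (gapExp p₁ p₂) * ((dyadic j)⁻¹ * shellRatio p₁ p₂ θ v₁ v₂ ω j)) := by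
  set x : ℤ → ℝ≥0∞ := fun j => 2 ^ (-(1 / 2 * |(j : ℝ) - k|)) *
    ((dyadic j)⁻¹ * shellRatio p₁ p₂ θ v₁ v₂ ω j)
  have e : (⨆ j : ℤ, 2 ^ (-(1 / 2 * |(j : ℝ) - k|)) *
        (unionConst (gapExp p₁ p₂) * ((dyadic j)⁻¹ * shellRatio p₁ p₂ θ v₁ v₂ ω j))) =
      unionConst (gapExp p₁ p₂) * ⨆ j, x j := by
    rw [ENNReal.mul_iSup]; congr 1; ext j; ring
  rw [e, mul_comm, ← div_eq_mul_inv, ENNReal.div_le_iff (dyadic_pos _).ne' (dyadic_ne_top _),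
    mul_assoc, mul_comm _ (dyadic k)]
  refine wNorm_le_of_iUnion (gapExp_pos hp₁) (ae_le_iUnion_radial_layer hn hω _) k fun j => ?_
  rcases lt_or_ge j k with hjk | hjk
  · have : radial n (sublevel θ ω (dyadic k)) ∩ radial n (layer θ ω j) = ∅ := by
      refine eq_empty_iff_forall_notMem.2 fun x hx => ?_
      have h1 : dyadic (j + 1) < dyadic k := hx.2.2.1.trans_le hx.1.2
      have := lt_of_dyadic_lt h1
      omega
    rw [this, wNorm_empty (gapExp_pos hp₁)]
    exact zero_le
  · calc _ ≤ shellRatio p₁ p₂ θ v₁ v₂ ω j := wNorm_mono_set inter_subset_right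
      _ = 2 ^ (-(1 / 2 * |(j : ℝ) - k|)) * (dyadic k * x j) := (two_rpow_dist_mul' hjk _).symm
      _ ≤ _ := by gcongr; exact le_iSup x j

/-- Testing the embedding on sums of almost extremal functions on shells. -/
theorem tsum_le_of_isEmbedConst (hn : 0 < n) (hp₁ : 0 < p₁) (hp : p₁ ≤ p₂) (hp₂ : p₂ < ∞)
    (hθ : 0 < θ) (hv₁ : IsWeight v₁) (hv₂ : IsWeight v₂) (hω : IsOmega θ ω) {c : ℝ≥0}
    (hc : IsEmbedConst (morreySpace p₂ θ ω v₂) (lebSpace p₁ v₁) (morreyNorm p₂ θ ω v₂)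
      (lebNorm p₁ v₁) c) (S : Finset ℤ) {a m : ℤ → ℝ≥0∞} (ha : ∀ k, a k ≠ ∞)
    (haS : ∀ k ∉ S, a k = 0) (hm : ∀ k, m k < shellRatio p₁ p₂ θ v₁ v₂ ω k ∨ m k = 0)
    {B : ℝ≥0∞} (hB : B ≠ ∞) (hB1 : θ = ∞ → ∀ k, dyadic k * a k ≤ B)
    (hB2 : θ ≠ ∞ → ∑' k, (dyadic k * a k) ^ θ.toReal ≤ B ^ θ.toReal) :
    (∑' k, (a k * m k) ^ p₁.toReal) ^ (1 / p₁.toReal) ≤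
      c * (unionConst θ * (unionConst p₂ * B)) := by
  have h1t : p₁ ≠ ∞ := (hp.trans_lt hp₂).ne
  have h2 : 0 < p₂ := hp₁.trans_le hp
  have hp' : 0 < p₁.toReal := ENNReal.toReal_pos hp₁.ne' h1t
  choose g hgm hg0 hg1 hg2 using fun k => exists_test hp₁ hp hp₂ hv₁ hv₂
    (measurableSet_radial (n := n) (measurableSet_layer (θ := θ) (ω := ω) k)) (hm k)
  set f : Rn n → ℝ := fun x => ∑ k ∈ S, (a k).toReal * g k x
  have hfm : AEMeasurable f :=
    Finset.aemeasurable_fun_sum _ fun k _ => (hgm k).const_mul _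
  have hf : ∀ j, ∀ x ∈ radial n (layer θ ω j), ‖f x‖ₑ = a j * ‖g j x‖ₑ := fun j x hx => by
    have h1 : f x = (a j).toReal * g j x := by
      refine Finset.sum_eq_single j (fun k _ hkj => ?_) (fun hj => by simp [haS j hj])
      rw [hg0 k x fun hk => hkj (layer_index_unique hk hx), mul_zero]
    rw [h1, enorm_mul, Real.enorm_eq_ofReal ENNReal.toReal_nonneg, ENNReal.ofReal_toReal (ha j)]
  have hshell : ∀ (p : ℝ≥0∞) (w : Rn n → ℝ≥0∞), 0 < p → ∀ j,
      wNorm p (radial n (layer θ ω j)) w (fun x => ‖f x‖ₑ) =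
        a j * wNorm p (radial n (layer θ ω j)) w (fun x => ‖g j x‖ₑ) := by
    intro p w hp j
    rw [← wNorm_const_mul hp (ha j)]
    have hae : ∀ᵐ x ∂volume.restrict (radial n (layer θ ω j)), ‖f x‖ₑ = a j * ‖g j x‖ₑ :=
      ae_restrict_of_forall_mem (measurableSet_radial (measurableSet_layer j)) (hf j)
    exact le_antisymm (wNorm_mono (hae.mono fun x hx => hx.le))
      (wNorm_mono (hae.mono fun x hx => hx.ge))
  have hfle : ∀ j, wNorm p₂ (radial n (layer θ ω j)) v₂ (fun x => ‖f x‖ₑ) ≤ a j := fun j => by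
    rw [hshell p₂ v₂ h2]
    exact mul_le_of_le_one_right' ((wNorm_mono_set (subset_univ _)).trans (hg1 j))
  set X : ℤ → ℝ≥0∞ := fun k => ⨆ j : ℤ, 2 ^ (-(1 / 2 * |(j : ℝ) - k|)) *
    (unionConst p₂ * (dyadic j * a j))
  -- A ball whose radius is in the k-th layer meets only shells with j ≤ k, where f has norm at most
  -- a_j.
  have hF : ∀ k, ∀ r ∈ layer θ ω k,
      dyadic k * wNorm p₂ (Metric.ball 0 r) v₂ (fun x => ‖f x‖ₑ) ≤ X k := by
    intro k r hr
    set x : ℤ → ℝ≥0∞ := fun j => 2 ^ (-(1 / 2 * |(j : ℝ) - k|)) * (dyadic j * a j)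
    have e : X k = unionConst p₂ * ⨆ j, x j := by
      rw [ENNReal.mul_iSup]; simp only [X]; congr 1; ext j; ring
    rw [e, mul_comm, ← ENNReal.le_div_iff_mul_le (Or.inl (dyadic_pos _).ne')
      (Or.inl (dyadic_ne_top _)), mul_div_assoc, div_eq_mul_inv, mul_comm _ (dyadic k)⁻¹]
    refine wNorm_le_of_iUnion h2 (ae_le_iUnion_radial_layer hn hω _) k fun j => ?_
    rcases lt_or_ge k j with hjk | hjk
    · have : Metric.ball 0 r ∩ radial n (layer θ ω j) = ∅ := by
        refine eq_empty_iff_forall_notMem.2 fun x hx => ?_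
        have := layer_index_le hx.2 hr (mem_ball_zero_iff.1 hx.1).le
        omega
      rw [this, wNorm_empty h2]
      exact zero_le
    · calc _ ≤ a j := (wNorm_mono_set inter_subset_right).trans (hfle j)
        _ = 2 ^ (-(1 / 2 * |(j : ℝ) - k|)) * ((dyadic k)⁻¹ * x j) :=
          (two_rpow_dist_mul hjk _).symm
        _ ≤ _ := by gcongr; exact le_iSup x j
  have hmorrey : morreyNorm p₂ θ ω v₂ f ≤ unionConst θ * (unionConst p₂ * B) := by
    by_cases hθ' : θ = ∞
    · subst hθ'
      refine (uNorm_top_mul_le_iSup hω hF).trans ((iSup_le_of_le_iSup fun k => le_rfl).trans ?_)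
      refine iSup_le fun k => ?_
      refine le_trans ?_ (le_mul_of_one_le_left' one_le_unionConst)
      gcongr
      exact hB1 rfl k
    · have hr := ENNReal.toReal_pos hθ.ne' hθ'
      refine (uNorm_mul_le_tsum hθ hθ' hω hF).trans ?_
      rw [one_div, ENNReal.rpow_inv_le_iff hr]
      refine (tsum_rpow_le_of_le_iSup hr fun k => le_rfl).trans ?_
      simp only [ENNReal.mul_rpow_of_nonneg _ _ hr.le, ENNReal.tsum_mul_left]
      have hU : unionConst θ ^ θ.toReal = geomSum (θ.toReal / 2) := by
        rw [unionConst, one_div, ENNReal.rpow_inv_rpow hr.ne']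
      rw [hU]
      gcongr
      simpa only [ENNReal.mul_rpow_of_nonneg _ _ hr.le] using hB2 hθ'
  -- Needed for local integrability only, so M is crude: the factor 2^{|j|/2} cancels the decay from
  -- index 0.
  have hfin : wNorm p₂ univ v₂ (fun x => ‖f x‖ₑ) < ∞ := by
    refine (wNorm_le_of_iUnion h2 (ae_le_iUnion_radial_layer hn hω univ) 0
      (M := ∑ j ∈ S, 2 ^ (1 / 2 * |(j : ℝ)|) * a j) fun j => ?_).trans_lt
        (ENNReal.mul_lt_top (unionConst_ne_top h2).lt_top (ENNReal.sum_lt_top.2 fun j _ =>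
          ENNReal.mul_lt_top (two_rpow_ne_top _).lt_top (ha j).lt_top))
    rw [univ_inter]
    refine (hfle j).trans ?_
    by_cases hj : j ∈ S
    · calc a j = 2 ^ (-(1 / 2 * |(j : ℝ) - (0 : ℤ)|)) * (2 ^ (1 / 2 * |(j : ℝ)|) * a j) := by
            rw [← mul_assoc, ← two_rpow_add]; simp
        _ ≤ _ := by
            gcongr
            exact Finset.single_le_sum (f := fun j : ℤ => (2 : ℝ≥0∞) ^ (1 / 2 * |(j : ℝ)|) * a j)
              (fun _ _ => zero_le) hj
    · rw [haS j hj]; exact zero_le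
  have hmem : f ∈ morreySpace p₂ θ ω v₂ :=
    ⟨⟨hfm, fun K _ => (wNorm_mono_set (subset_univ K)).trans_lt hfin⟩, hmorrey.trans_lt
      (ENNReal.mul_lt_top (unionConst_ne_top hθ).lt_top
        (ENNReal.mul_lt_top (unionConst_ne_top h2).lt_top hB.lt_top))⟩
  calc (∑' k, (a k * m k) ^ p₁.toReal) ^ (1 / p₁.toReal)
      ≤ lebNorm p₁ v₁ f := by
        rw [lebNorm, one_div, ENNReal.rpow_inv_le_iff hp', wNorm_rpow hp₁.ne' h1t]
        refine le_trans ?_ (lintegral_mono_set (subset_univ (⋃ k, radial n (layer θ ω k))))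
        rw [lintegral_iUnion (fun k => measurableSet_radial (measurableSet_layer k))
          pairwise_disjoint_radial_layer]
        refine ENNReal.tsum_le_tsum fun k => ?_
        rw [← wNorm_rpow hp₁.ne' h1t, hshell p₁ v₁ hp₁]
        gcongr
        exact hg2 k
    _ ≤ c * morreyNorm p₂ θ ω v₂ f := hc.2 f hmem
    _ ≤ _ := by gcongr

end Test

/-! ### Lower bounds for an embedding constant. -/

section Necessity

variable {c : ℝ≥0}

/-- Converse of Hölder for series. Finiteness of S and of the m_k makes M finite, so that M^{1/p₁} ≤
const · M^{1/θ} can be divided to give M^{1/s} ≤ const. -/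
theorem sum_shellRatio_le_of_lt (hn : 0 < n) (hp₁ : 0 < p₁) (hp : p₁ ≤ p₂) (hp₂ : p₂ < ∞)
    (hθ : p₁ < θ) (hv₁ : IsWeight v₁) (hv₂ : IsWeight v₂) (hω : IsOmega θ ω)
    (hc : IsEmbedConst (morreySpace p₂ θ ω v₂) (lebSpace p₁ v₁) (morreyNorm p₂ θ ω v₂)
      (lebNorm p₁ v₁) c) (S : Finset ℤ) {m : ℤ → ℝ≥0∞} (hmt : ∀ k, m k ≠ ∞)
    (hm : ∀ k, m k < shellRatio p₁ p₂ θ v₁ v₂ ω k ∨ m k = 0) :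
    (∑ k ∈ S, ((dyadic k)⁻¹ * m k) ^ (gapExp p₁ θ).toReal) ^ (1 / (gapExp p₁ θ).toReal) ≤
      c * (unionConst θ * unionConst p₂) := by
  have h1t : p₁ ≠ ∞ := (hp.trans_lt hp₂).ne
  have hp' : 0 < p₁.toReal := ENNReal.toReal_pos hp₁.ne' h1t
  have hs : 0 < (gapExp p₁ θ).toReal :=
    ENNReal.toReal_pos (gapExp_pos hp₁).ne' (gapExp_ne_top hθ)
  have hsp := one_div_gapExp_toReal hp₁ hθ.le
  have hτ : 0 ≤ (θ⁻¹).toReal := ENNReal.toReal_nonneg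
  have hτθ : θ ≠ ∞ → (θ⁻¹).toReal * θ.toReal = 1 := fun h => by
    rw [ENNReal.toReal_inv, inv_mul_cancel₀ (ENNReal.toReal_pos (hp₁.trans hθ).ne' h).ne']
  have hτ0 : θ = ∞ → (θ⁻¹).toReal = 0 := fun h => by simp [h]
  set s := (gapExp p₁ θ).toReal
  set p := p₁.toReal with hpdef
  set τ := (θ⁻¹).toReal
  set μ : ℤ → ℝ≥0∞ := fun k => (dyadic k)⁻¹ * m k
  have hd : ∀ k, (dyadic k)⁻¹ ≠ ∞ := fun k => ENNReal.inv_ne_top.2 (dyadic_pos k).ne'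
  have hμ : ∀ k, μ k ≠ ∞ := fun k => ENNReal.mul_ne_top (hd k) (hmt k)
  have hexp : (s * τ + 1) * p = s := by
    have h1 : τ = 1 / p - 1 / s := by rw [hsp]; ring
    rw [h1]; field_simp; ring
  set M := ∑ k ∈ S, μ k ^ s with hM
  have hMt : M ≠ ∞ := (ENNReal.sum_lt_top.2 fun k _ =>
    ENNReal.rpow_lt_top_of_nonneg hs.le (hμ k)).ne
  rcases eq_or_ne M 0 with hM0 | hM0
  · rw [hM0, ENNReal.zero_rpow_of_pos (by positivity)]; exact zero_le
  -- With τ = 1/θ, zero at θ = ∞, this choice gives (a_k m_k)^{p₁} = μ_k^s, and (2^{-k} a_k)^θ =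
  -- μ_k^s for θ < ∞.
  set a : ℤ → ℝ≥0∞ := fun k => if k ∈ S then (dyadic k)⁻¹ * μ k ^ (s * τ) else 0
  have hda : ∀ k ∈ S, dyadic k * a k = μ k ^ (s * τ) := fun k hk => by
    simp only [a, if_pos hk]
    rw [← mul_assoc, ENNReal.mul_inv_cancel (dyadic_pos k).ne' (dyadic_ne_top k), one_mul]
  have haS : ∀ k ∉ S, a k = 0 := fun k hk => if_neg hk
  have hsum : ∑' k, (a k * m k) ^ p = M := by
    rw [tsum_eq_sum (s := S) fun k hk => by rw [haS k hk, zero_mul, ENNReal.zero_rpow_of_pos hp']]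
    refine Finset.sum_congr rfl fun k hk => ?_
    have : a k * m k = μ k ^ (s * τ + 1) := by
      rw [ENNReal.rpow_add_of_nonneg _ _ (by positivity) zero_le_one, ENNReal.rpow_one]
      simp only [a, if_pos hk, μ]; ring
    rw [this, ← ENNReal.rpow_mul, hexp]
  have key := tsum_le_of_isEmbedConst hn hp₁ hp hp₂ (hp₁.trans hθ) hv₁ hv₂ hω hc S (a := a)
    (m := m) (B := M ^ τ) (fun k => ?_) haS hm (ENNReal.rpow_ne_top_of_nonneg hτ hMt) ?_ ?_
  · rw [← hpdef, hsum] at key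
    have h1 : M ^ (1 / s) = M ^ (1 / p) * (M ^ τ)⁻¹ := by
      rw [hsp, ENNReal.rpow_sub _ _ hM0 hMt, div_eq_mul_inv]
    have h2 : M ^ τ ≠ 0 := by
      rw [Ne, ENNReal.rpow_eq_zero_iff]; rintro (h | h); exacts [hM0 h.1, hMt h.1]
    rw [h1, ← div_eq_mul_inv, ENNReal.div_le_iff h2 (ENNReal.rpow_ne_top_of_nonneg hτ hMt)]
    refine key.trans (le_of_eq (by ring))
  · simp only [a]; split_ifs
    · exact ENNReal.mul_ne_top (hd k) (ENNReal.rpow_ne_top_of_nonneg (by positivity) (hμ k))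
    · exact ENNReal.zero_ne_top
  · intro h k
    rw [hτ0 h, ENNReal.rpow_zero]
    by_cases hk : k ∈ S
    · rw [hda k hk, hτ0 h, mul_zero, ENNReal.rpow_zero]
    · rw [haS k hk, mul_zero]; exact zero_le
  · intro h
    have hr := ENNReal.toReal_pos (hp₁.trans hθ).ne' h
    rw [tsum_eq_sum (s := S) fun k hk => by rw [haS k hk, mul_zero, ENNReal.zero_rpow_of_pos hr],
      ← ENNReal.rpow_mul, hτθ h, ENNReal.rpow_one]
    refine Finset.sum_le_sum fun k hk => ?_
    rw [hda k hk, ← ENNReal.rpow_mul, mul_assoc, hτθ h, mul_one]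

/-- Singletons first show that each shell norm is finite. Then half of it is an admissible strict
lower value, whence the factor 2. -/
theorem tsum_shellRatio_le (hn : 0 < n) (hp₁ : 0 < p₁) (hp : p₁ ≤ p₂) (hp₂ : p₂ < ∞)
    (hθ : p₁ < θ) (hv₁ : IsWeight v₁) (hv₂ : IsWeight v₂) (hω : IsOmega θ ω)
    (hc : IsEmbedConst (morreySpace p₂ θ ω v₂) (lebSpace p₁ v₁) (morreyNorm p₂ θ ω v₂)
      (lebNorm p₁ v₁) c) :
    (∑' k, ((dyadic k)⁻¹ * shellRatio p₁ p₂ θ v₁ v₂ ω k) ^ (gapExp p₁ θ).toReal) ^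
      (1 / (gapExp p₁ θ).toReal) ≤ 2 * (c * (unionConst θ * unionConst p₂)) := by
  have hs : 0 < (gapExp p₁ θ).toReal :=
    ENNReal.toReal_pos (gapExp_pos hp₁).ne' (gapExp_ne_top hθ)
  have hCt : (c : ℝ≥0∞) * (unionConst θ * unionConst p₂) ≠ ∞ :=
    ENNReal.mul_ne_top ENNReal.coe_ne_top (ENNReal.mul_ne_top (unionConst_ne_top (hp₁.trans hθ))
      (unionConst_ne_top (hp₁.trans_le hp)))
  have hfin : ∀ k, shellRatio p₁ p₂ θ v₁ v₂ ω k ≠ ∞ := fun k => by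
    refine ne_top_of_le_ne_top (ENNReal.mul_ne_top (dyadic_ne_top k) hCt)
      (le_of_forall_lt_imp_le_of_dense fun m hm => ?_)
    have := sum_shellRatio_le_of_lt hn hp₁ hp hp₂ hθ hv₁ hv₂ hω hc {k}
      (m := fun j => if j = k then m else 0)
      (fun j => by split_ifs; exacts [hm.ne_top, ENNReal.zero_ne_top])
      (fun j => by split_ifs with h; exacts [Or.inl (h ▸ hm), Or.inr rfl])
    rw [Finset.sum_singleton, if_pos rfl, one_div, ENNReal.rpow_rpow_inv hs.ne', mul_comm,
      ← div_eq_mul_inv, ENNReal.div_le_iff (dyadic_pos k).ne' (dyadic_ne_top k)] at this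
    rwa [mul_comm]
  rw [one_div, ENNReal.rpow_inv_le_iff hs, ENNReal.tsum_eq_iSup_sum]
  refine iSup_le fun S => ?_
  rw [← ENNReal.rpow_inv_le_iff hs, ← one_div]
  have := sum_shellRatio_le_of_lt hn hp₁ hp hp₂ hθ hv₁ hv₂ hω hc S
    (m := fun j => shellRatio p₁ p₂ θ v₁ v₂ ω j / 2)
    (fun j => ENNReal.div_ne_top (hfin j) (by norm_num))
    (fun j => by
      rcases eq_or_ne (shellRatio p₁ p₂ θ v₁ v₂ ω j) 0 with h | h
      · exact Or.inr (by simp [h])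
      · exact Or.inl (ENNReal.half_lt_self h (hfin j)))
  refine le_trans (le_of_eq ?_) (mul_le_mul_right this 2)
  have e : ∀ Y : ℝ≥0∞, 2 * Y ^ (1 / (gapExp p₁ θ).toReal) =
      (2 ^ (gapExp p₁ θ).toReal * Y) ^ (1 / (gapExp p₁ θ).toReal) := fun Y => by
    rw [ENNReal.mul_rpow_of_nonneg _ _ (by positivity), one_div, ENNReal.rpow_rpow_inv hs.ne']
  rw [e, Finset.mul_sum]
  congr 2; ext k
  rw [← ENNReal.mul_rpow_of_nonneg _ _ hs.le, mul_left_comm, ENNReal.mul_div_cancel (by norm_num)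
    (by norm_num)]

/-- An almost extremal f vanishing on B(0,t) has zero norm on balls of radius r ≤ t and norm at most
1 on the others, hence Morrey norm at most T(t). -/
theorem tail_inv_mul_ratioNorm_le (hp₁ : 0 < p₁) (hp : p₁ ≤ p₂) (hp₂ : p₂ < ∞)
    (hθ : 0 < θ) (hθ' : θ ≠ ∞) (hv₁ : IsWeight v₁) (hv₂ : IsWeight v₂) (hω : IsOmega θ ω)
    (hc : IsEmbedConst (morreySpace p₂ θ ω v₂) (lebSpace p₁ v₁) (morreyNorm p₂ θ ω v₂)
      (lebNorm p₁ v₁) c) {t : ℝ} (ht : 0 < t) :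
    (tail θ ω t)⁻¹ * ratioNorm p₁ p₂ v₁ v₂ (Metric.ball 0 t)ᶜ ≤ c := by
  have hr := ENNReal.toReal_pos hθ.ne' hθ'
  have h2 : 0 < p₂ := hp₁.trans_le hp
  have hq := ENNReal.toReal_pos h2.ne' hp₂.ne
  rw [mul_comm, ← div_eq_mul_inv, ENNReal.div_le_iff (hω.2 t ht).1.ne' (hω.2 t ht).2.ne]
  refine le_of_forall_lt_imp_le_of_dense fun m hm => ?_
  obtain ⟨f, hfm, hf0, hf1, hf2⟩ := exists_test hp₁ hp hp₂ hv₁ hv₂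
    Metric.isOpen_ball.measurableSet.compl (Or.inl hm)
  have hball : ∀ r, r ≤ t → wNorm p₂ (Metric.ball 0 r) v₂ (fun x => ‖f x‖ₑ) = 0 := by
    intro r hrt
    rw [wNorm_of_ne_top hp₂.ne, setLIntegral_congr_fun (g := fun _ => 0)
      Metric.isOpen_ball.measurableSet]
    · simp [hq]
    · intro x hx
      have : f x = 0 := hf0 x fun h => h (Metric.ball_subset_ball hrt hx)
      simp [this, hq]
  have hmorrey : morreyNorm p₂ θ ω v₂ f ≤ tail θ ω t := by
    rw [morreyNorm, tail, uNorm_of_ne_top hθ', uNorm_of_ne_top hθ']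
    refine ENNReal.rpow_le_rpow ?_ (by positivity)
    rw [← lintegral_indicator measurableSet_Ioi, ← lintegral_indicator measurableSet_Ioi]
    refine lintegral_mono fun r => ?_
    rcases lt_or_ge t r with h | h
    · rw [indicator_of_mem (mem_Ioi.2 (ht.trans h)), indicator_of_mem (mem_Ioi.2 h)]
      refine ENNReal.rpow_le_rpow ?_ hr.le
      exact mul_le_of_le_one_right' ((wNorm_mono_set (subset_univ _)).trans hf1)
    · refine le_trans (le_of_eq ?_) zero_le
      rw [indicator_apply_eq_zero]
      intro _
      rw [hball r h, mul_zero, ENNReal.zero_rpow_of_pos hr]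
  have hmem : f ∈ morreySpace p₂ θ ω v₂ :=
    ⟨⟨hfm, fun K _ => (wNorm_mono_set (subset_univ K)).trans_lt
      (hf1.trans_lt ENNReal.one_lt_top)⟩, hmorrey.trans_lt (hω.2 t ht).2⟩
  calc m ≤ lebNorm p₁ v₁ f := hf2.trans (wNorm_mono_set (subset_univ _))
    _ ≤ c * morreyNorm p₂ θ ω v₂ f := hc.2 f hmem
    _ ≤ _ := by gcongr

end Necessity

/-! ### The two-sided estimates with explicit constants. -/

section MainEstimates

/-- The right-hand side in the case `p₁ < θ`. -/
def stieltjesNorm (p₁ p₂ θ : ℝ≥0∞) (v₁ v₂ : Rn n → ℝ≥0∞) (ω : ℝ → ℝ≥0∞) : ℝ≥0∞ :=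
  (∫⁻ t, ratioNorm p₁ p₂ v₁ v₂ (Metric.ball 0 t)ᶜ ^ (gapExp p₁ θ).toReal
      ∂(lsMeasure (tailPow θ ω (gapExp p₁ θ).toReal))) ^ (1 / (gapExp p₁ θ).toReal) +
    (tail θ ω 0)⁻¹ * ratioNorm p₁ p₂ v₁ v₂ univ

/-- The constant of the discretization of the Morrey norm. -/
def innerConst (θ : ℝ≥0∞) : ℝ≥0∞ := 2 * layerConst θ ^ (1 / θ.toReal)

theorem innerConst_ne_top (hθ : 0 < θ) : innerConst θ ≠ ∞ := by
  refine ENNReal.mul_ne_top (by norm_num) ?_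
  by_cases h : θ = ∞
  · simp [h]
  · exact ENNReal.rpow_ne_top_of_nonneg (by positivity) (layerConst_ne_top hθ h)

/-- `layerConst ∞` is infinite, but its exponent is `1 / 0 = 0`. -/
theorem innerConst_top : innerConst ∞ = 2 := by simp [innerConst]

theorem idNorm_le_iSup (hn : 0 < n) (hp₁ : 0 < p₁) (hp : p₁ ≤ p₂) (hp₂ : p₂ < ∞) (hθ : 0 < θ)
    (hθp : θ ≤ p₁) (hv₁ : IsWeight v₁) (hv₂ : IsWeight v₂) (hω : IsOmega θ ω) :
    idNorm p₁ p₂ θ v₁ v₂ ω ≤ innerConst θ * ⨆ (t : ℝ) (_ : 0 < t),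
      (tail θ ω t)⁻¹ * ratioNorm p₁ p₂ v₁ v₂ (Metric.ball 0 t)ᶜ := by
  have h1t : p₁ ≠ ∞ := (hp.trans_lt hp₂).ne
  have hθ' : θ ≠ ∞ := ne_top_of_le_ne_top h1t hθp
  have hr := ENNReal.toReal_pos hθ.ne' hθ'
  refine idNorm_le fun f hf => ?_
  set S := ⨆ (t : ℝ) (_ : 0 < t), (tail θ ω t)⁻¹ * ratioNorm p₁ p₂ v₁ v₂ (Metric.ball 0 t)ᶜ
    with hS
  have hSt : ∀ t, 0 < t → (tail θ ω t)⁻¹ * ratioNorm p₁ p₂ v₁ v₂ (Metric.ball 0 t)ᶜ ≤ S :=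
    fun t ht => le_iSup₂ (f := fun (t : ℝ) (_ : 0 < t) =>
      (tail θ ω t)⁻¹ * ratioNorm p₁ p₂ v₁ v₂ (Metric.ball 0 t)ᶜ) t ht
  refine (lebNorm_le_tsum hn hp₁ hp hp₂ hv₁ hv₂ hω hf).trans
    ((tsum_rpow_le_tsum_rpow hr (ENNReal.toReal_mono h1t hθp) _).trans ?_)
  calc _ ≤ (∑' k, (S * (dyadic k * innerNorm p₂ θ v₂ ω f (k + 1))) ^ θ.toReal) ^
          (1 / θ.toReal) := by
        refine ENNReal.rpow_le_rpow (ENNReal.tsum_le_tsum fun k => ?_) (by positivity)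
        refine ENNReal.rpow_le_rpow ?_ hr.le
        gcongr
        exact outerRatio_le_of_forall hp₁ hω hSt k
    _ = S * (∑' k, (dyadic k * innerNorm p₂ θ v₂ ω f (k + 1)) ^ θ.toReal) ^
          (1 / θ.toReal) := by
        simp only [ENNReal.mul_rpow_of_nonneg S _ hr.le, ENNReal.tsum_mul_left]
        rw [ENNReal.mul_rpow_of_nonneg _ _ (by positivity), one_div,
          ENNReal.rpow_rpow_inv hr.ne']
    _ ≤ S * (innerConst θ * morreyNorm p₂ θ ω v₂ f) := by
        gcongr
        exact tsum_innerNorm_le (hp₁.trans_le hp) hθ hθ' hω f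
    _ = _ := by ring

theorem iSup_le_idNorm (hp₁ : 0 < p₁) (hp : p₁ ≤ p₂) (hp₂ : p₂ < ∞) (hθ : 0 < θ)
    (hθp : θ ≤ p₁) (hv₁ : IsWeight v₁) (hv₂ : IsWeight v₂) (hω : IsOmega θ ω) {C : ℝ≥0}
    (hC : 1 ≤ C) :
    (⨆ (t : ℝ) (_ : 0 < t), (tail θ ω t)⁻¹ * ratioNorm p₁ p₂ v₁ v₂ (Metric.ball 0 t)ᶜ) ≤
      C * idNorm p₁ p₂ θ v₁ v₂ ω := by
  refine le_mul_embedNorm (one_pos.trans_le hC) fun c hc => iSup₂_le fun t ht => ?_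
  refine (tail_inv_mul_ratioNorm_le hp₁ hp hp₂ hθ
    (ne_top_of_le_ne_top (hp.trans_lt hp₂).ne hθp) hv₁ hv₂ hω hc ht).trans ?_
  exact le_mul_of_one_le_left' (by exact_mod_cast hC)

/-- The constant in the upper bound in the case `p₁ < θ`. -/
def upperConst (p₁ θ : ℝ≥0∞) : ℝ≥0∞ :=
  (geomSum (gapExp p₁ θ).toReal * 2) ^ (1 / (gapExp p₁ θ).toReal) * innerConst θ

theorem upperConst_ne_top (hp₁ : 0 < p₁) (hθ : p₁ < θ) : upperConst p₁ θ ≠ ∞ := by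
  have hs : 0 < (gapExp p₁ θ).toReal :=
    ENNReal.toReal_pos (gapExp_pos hp₁).ne' (gapExp_ne_top hθ)
  exact ENNReal.mul_ne_top (ENNReal.rpow_ne_top_of_nonneg (by positivity)
    (ENNReal.mul_ne_top (geomSum_ne_top hs) (by norm_num))) (innerConst_ne_top (hp₁.trans hθ))

theorem idNorm_le_stieltjesNorm (hn : 0 < n) (hp₁ : 0 < p₁) (hp : p₁ ≤ p₂) (hp₂ : p₂ < ∞)
    (hθ : p₁ < θ) (hv₁ : IsWeight v₁) (hv₂ : IsWeight v₂) (hω : IsOmega θ ω) :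
    idNorm p₁ p₂ θ v₁ v₂ ω ≤ upperConst p₁ θ * stieltjesNorm p₁ p₂ θ v₁ v₂ ω := by
  have h1t : p₁ ≠ ∞ := (hp.trans_lt hp₂).ne
  have hθ0 : 0 < θ := hp₁.trans hθ
  have hp' : 0 < p₁.toReal := ENNReal.toReal_pos hp₁.ne' h1t
  have hs : 0 < (gapExp p₁ θ).toReal :=
    ENNReal.toReal_pos (gapExp_pos hp₁).ne' (gapExp_ne_top hθ)
  refine idNorm_le fun f hf => (lebNorm_le_tsum hn hp₁ hp hp₂ hv₁ hv₂ hω hf).trans ?_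
  have hK : (∑' k, ((dyadic k)⁻¹ * outerRatio p₁ p₂ θ v₁ v₂ ω k) ^ (gapExp p₁ θ).toReal) ^
      (1 / (gapExp p₁ θ).toReal) ≤
      (geomSum (gapExp p₁ θ).toReal * 2) ^ (1 / (gapExp p₁ θ).toReal) *
        stieltjesNorm p₁ p₂ θ v₁ v₂ ω := by
    rw [one_div, ENNReal.rpow_inv_le_iff hs, ENNReal.mul_rpow_of_nonneg _ _ hs.le,
      ENNReal.rpow_inv_rpow hs.ne', mul_assoc]
    refine (tsum_outerRatio_le hp₁ hθ0 hω hs).trans ?_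
    gcongr
    rw [two_mul]
    refine add_le_add ?_ ?_
    · rw [← ENNReal.rpow_inv_le_iff hs, ← one_div]
      exact le_self_add
    · rw [← ENNReal.mul_rpow_of_nonneg _ _ hs.le]
      exact ENNReal.rpow_le_rpow le_add_self hs.le
  -- At θ = ∞ one has s = p₁, and a uniform bound on the second factor replaces Hölder's inequality.
  by_cases hθ' : θ = ∞
  · subst hθ'
    have e : (gapExp p₁ ∞).toReal = p₁.toReal := by rw [gapExp_top]
    calc _ ≤ (∑' k, (((dyadic k)⁻¹ * outerRatio p₁ p₂ ∞ v₁ v₂ ω k) *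
            (2 * morreyNorm p₂ ∞ ω v₂ f)) ^ p₁.toReal) ^ (1 / p₁.toReal) := by
          refine ENNReal.rpow_le_rpow (ENNReal.tsum_le_tsum fun k => ?_) (by positivity)
          refine ENNReal.rpow_le_rpow ?_ hp'.le
          exact mul_le_mul_right (innerNorm_top_le (hp₁.trans_le hp) f k) _
      _ = (∑' k, ((dyadic k)⁻¹ * outerRatio p₁ p₂ ∞ v₁ v₂ ω k) ^ p₁.toReal) ^ (1 / p₁.toReal) *
            (2 * morreyNorm p₂ ∞ ω v₂ f) := by
          simp only [ENNReal.mul_rpow_of_nonneg _ (2 * morreyNorm p₂ ∞ ω v₂ f) hp'.le,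
            ENNReal.tsum_mul_right]
          rw [ENNReal.mul_rpow_of_nonneg _ _ (by positivity), one_div,
            ENNReal.rpow_rpow_inv hp'.ne']
      _ ≤ _ := by
          rw [← e]
          refine (mul_le_mul_left hK _).trans (le_of_eq ?_)
          rw [upperConst, innerConst_top]; ring
  · have hr := ENNReal.toReal_pos hθ0.ne' hθ'
    have hexp := one_div_gapExp_toReal hp₁ hθ.le
    rw [ENNReal.toReal_inv] at hexp
    refine (tsum_mul_rpow_le hp' hs hr (by rw [hexp]; ring) _ _).trans ?_
    refine (mul_le_mul' hK (tsum_innerNorm_le (hp₁.trans_le hp) hθ0 hθ' hω f)).trans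
      (le_of_eq ?_)
    rw [upperConst, innerConst]; ring

/-- The constant in the lower bound in the case `p₁ < θ`. -/
def lowerConst (p₁ p₂ θ : ℝ≥0∞) : ℝ≥0∞ :=
  8 * (geomSum ((gapExp p₁ θ).toReal / 2) ^ (1 / (gapExp p₁ θ).toReal) *
    unionConst (gapExp p₁ p₂) * (unionConst θ * unionConst p₂))

theorem lowerConst_ne_top (hp₁ : 0 < p₁) (hp : p₁ ≤ p₂) (hθ : p₁ < θ) :
    lowerConst p₁ p₂ θ ≠ ∞ := by
  have hs : 0 < (gapExp p₁ θ).toReal :=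
    ENNReal.toReal_pos (gapExp_pos hp₁).ne' (gapExp_ne_top hθ)
  exact ENNReal.mul_ne_top (by norm_num) (ENNReal.mul_ne_top (ENNReal.mul_ne_top
    (ENNReal.rpow_ne_top_of_nonneg (by positivity) (geomSum_ne_top (by positivity)))
    (unionConst_ne_top (gapExp_pos hp₁))) (ENNReal.mul_ne_top
      (unionConst_ne_top (hp₁.trans hθ)) (unionConst_ne_top (hp₁.trans_le hp))))

/-- Both summands are at most twice the ℓ^s norm N of the exterior sequence, and the Hardy step
bounds N by the shell sequence. With the factor 2 of `tsum_shellRatio_le` this gives the 8 in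
`lowerConst`. -/
theorem stieltjesNorm_le_idNorm (hn : 0 < n) (hp₁ : 0 < p₁) (hp : p₁ ≤ p₂) (hp₂ : p₂ < ∞)
    (hθ : p₁ < θ) (hv₁ : IsWeight v₁) (hv₂ : IsWeight v₂) (hω : IsOmega θ ω) {C : ℝ≥0}
    (hC0 : 0 < C) (hC : lowerConst p₁ p₂ θ ≤ C) :
    stieltjesNorm p₁ p₂ θ v₁ v₂ ω ≤ C * idNorm p₁ p₂ θ v₁ v₂ ω := by
  have hθ0 : 0 < θ := hp₁.trans hθ
  have hs : 0 < (gapExp p₁ θ).toReal :=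
    ENNReal.toReal_pos (gapExp_pos hp₁).ne' (gapExp_ne_top hθ)
  refine le_mul_embedNorm hC0 fun c hc => ?_
  have hK := tsum_shellRatio_le hn hp₁ hp hp₂ hθ hv₁ hv₂ hω hc
  have h1 := lintegral_lsMeasure_le (p₁ := p₁) (p₂ := p₂) (v₁ := v₁) (v₂ := v₂) hθ0 hω hs
  have h2 := tail_zero_inv_mul_le (p₁ := p₁) (p₂ := p₂) (v₁ := v₁) (v₂ := v₂) hn hω hs
  have h3 := tsum_rpow_le_of_le_iSup hs
    (outerRatio_le_iSup (p₁ := p₁) (p₂ := p₂) (v₁ := v₁) (v₂ := v₂) hn hp₁ hω)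
  rw [stieltjesNorm]
  set s := (gapExp p₁ θ).toReal
  set N := (∑' k, ((dyadic k)⁻¹ * outerRatio p₁ p₂ θ v₁ v₂ ω k) ^ s) ^ (1 / s) with hN
  have hN1 : N ≤ geomSum (s / 2) ^ (1 / s) * unionConst (gapExp p₁ p₂) *
      (2 * (c * (unionConst θ * unionConst p₂))) := by
    refine (ENNReal.rpow_le_rpow h3 (by positivity)).trans ?_
    simp only [ENNReal.mul_rpow_of_nonneg (unionConst (gapExp p₁ p₂)) _ hs.le,
      ENNReal.tsum_mul_left]
    rw [ENNReal.mul_rpow_of_nonneg _ _ (by positivity : 0 ≤ 1 / s),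
      ENNReal.mul_rpow_of_nonneg _ _ (by positivity : 0 ≤ 1 / s), ← mul_assoc, ← ENNReal.rpow_mul,
      mul_one_div_cancel hs.ne', ENNReal.rpow_one]
    gcongr
  have h4 : (∫⁻ t, ratioNorm p₁ p₂ v₁ v₂ (Metric.ball 0 t)ᶜ ^ s ∂(lsMeasure (tailPow θ ω s))) ^
      (1 / s) ≤ 2 * N := by
    refine (ENNReal.rpow_le_rpow h1 (by positivity)).trans (le_of_eq ?_)
    rw [ENNReal.mul_rpow_of_nonneg _ _ (by positivity), ← ENNReal.rpow_mul,
      mul_one_div_cancel hs.ne', ENNReal.rpow_one]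
  calc _ ≤ 2 * N + 2 * N := add_le_add h4 h2
    _ = 4 * N := by ring
    _ ≤ 4 * (geomSum (s / 2) ^ (1 / s) * unionConst (gapExp p₁ p₂) *
      (2 * (c * (unionConst θ * unionConst p₂)))) := by gcongr
    _ = lowerConst p₁ p₂ θ * c := by rw [lowerConst]; ring
    _ ≤ _ := by gcongr

end MainEstimates

end LocalMorrey

end

/-! ### Assembly with a single constant. -/

theorem mainTheorem3 (n : ℕ) (hn : 0 < n) (p₁ p₂ θ : ℝ≥0∞)
    (hp₁ : 0 < p₁) (hp : p₁ ≤ p₂) (hp₂ : p₂ < ∞) (hθ : 0 < θ) :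
    -- the constant `C` depends only on `n`, `p₁`, `p₂`, `θ`
    ∃ C : ℝ≥0, 0 < C ∧
      ∀ v₁ v₂ : Rn n → ℝ≥0∞, IsWeight v₁ → IsWeight v₂ →
      ∀ ω : ℝ → ℝ≥0∞, IsOmega θ ω →
        (θ ≤ p₁ →
          idNorm p₁ p₂ θ v₁ v₂ ω ≤
              C * (⨆ (t : ℝ) (_ : 0 < t),
                (tail θ ω t)⁻¹ * ratioNorm p₁ p₂ v₁ v₂ (Metric.ball 0 t)ᶜ) ∧
          (⨆ (t : ℝ) (_ : 0 < t),
                (tail θ ω t)⁻¹ * ratioNorm p₁ p₂ v₁ v₂ (Metric.ball 0 t)ᶜ) ≤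
              C * idNorm p₁ p₂ θ v₁ v₂ ω) ∧
        (p₁ < θ →
          idNorm p₁ p₂ θ v₁ v₂ ω ≤
              C * ((∫⁻ t, ratioNorm p₁ p₂ v₁ v₂ (Metric.ball 0 t)ᶜ ^ (gapExp p₁ θ).toReal
                      ∂(lsMeasure (tailPow θ ω (gapExp p₁ θ).toReal))) ^
                    (1 / (gapExp p₁ θ).toReal) +
                (tail θ ω 0)⁻¹ * ratioNorm p₁ p₂ v₁ v₂ univ) ∧
          (∫⁻ t, ratioNorm p₁ p₂ v₁ v₂ (Metric.ball 0 t)ᶜ ^ (gapExp p₁ θ).toReal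
                      ∂(lsMeasure (tailPow θ ω (gapExp p₁ θ).toReal))) ^
                    (1 / (gapExp p₁ θ).toReal) +
                (tail θ ω 0)⁻¹ * ratioNorm p₁ p₂ v₁ v₂ univ ≤
              C * idNorm p₁ p₂ θ v₁ v₂ ω) := by
  have hθC : innerConst θ ≠ ∞ := innerConst_ne_top hθ
  -- These constants are shown to be finite only for p₁ < θ, the only case that uses them.
  set U : ℝ≥0∞ := if p₁ < θ then upperConst p₁ θ + lowerConst p₁ p₂ θ else 0 with hU
  have hUt : U ≠ ∞ := by
    rw [hU]
    split_ifs with h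
    · exact ENNReal.add_ne_top.2 ⟨upperConst_ne_top hp₁ h, lowerConst_ne_top hp₁ hp h⟩
    · exact ENNReal.zero_ne_top
  set C : ℝ≥0 := 1 + (innerConst θ).toNNReal + U.toNNReal
  have hC1 : 1 ≤ C := le_self_add.trans le_self_add
  have hCin : innerConst θ ≤ C := by
    rw [← ENNReal.coe_toNNReal hθC]
    exact_mod_cast le_add_self.trans le_self_add
  have hCU : U ≤ C := by
    rw [← ENNReal.coe_toNNReal hUt]
    exact_mod_cast le_add_self
  refine ⟨C, one_pos.trans_le hC1, fun v₁ v₂ hv₁ hv₂ ω hω => ⟨fun h => ⟨?_, ?_⟩, fun h => ?_⟩⟩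
  · refine (idNorm_le_iSup hn hp₁ hp hp₂ hθ h hv₁ hv₂ hω).trans ?_
    gcongr
  · exact iSup_le_idNorm hp₁ hp hp₂ hθ h hv₁ hv₂ hω hC1
  · rw [hU, if_pos h] at hCU
    refine ⟨(idNorm_le_stieltjesNorm hn hp₁ hp hp₂ h hv₁ hv₂ hω).trans ?_,
      stieltjesNorm_le_idNorm hn hp₁ hp hp₂ h hv₁ hv₂ hω (one_pos.trans_le hC1)
        (le_add_self.trans hCU)⟩
    exact mul_le_mul_left (le_self_add.trans hCU) _
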